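/- Let $n\ge 6$ and $\lambda=(2^2,1^{n-4})$. Let $M^\lambda$ be the free $\mathbb Z$-module on the $\lambda$-tabloids $\{a\}$ (tableaux $[a]$ filled bijectively with $1,\dots,n$, with unordered rows), with the right operation of $S_n$ on entries and with the bilinear form $(-,-)$ for which the tabloids are orthonormal. For a tableau $[a]$ with column stabilizer $C_a$ and row stabilizer $R_a$, let $\langle a\rangle=\sum_{\sigma\in C_a}\operatorname{sgn}(\sigma)\{a\}\sigma$ be its polytabloid and $\langle a\rangle\rho^+=\sum_{\sigma\in R_a}\langle a\rangle\sigma$. The Specht module $S^\lambda\subseteq M^\lambda$ is the $\mathbb Z$-span of the polytabloids, $S^{\lambda,*}=\operatorname{Hom}_{\mathbb Z}(S^\lambda,\mathbb Z)$, and $S^{\lambda,*}/S^\lambda$ denotes the cokernel of $S^\lambda\to S^{\lambda,*}$, $\xi\mapsto(\xi,-)$. Put $[A]=1$ if the assertion $A$ holds and $[A]=0$ otherwise. Then, as abelian groups, \[ \begin{aligned} S^{\lambda,*}/S^\lambda\;\cong\;{}&\mathbb Z/2^{[n\text{ odd}]}\cdot 2(n-4)!\;\oplus\;\bigl(\mathbb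 Z/(n-1)\cdot 2(n-4)!\bigr)^{n-3}\\ &\oplus\;\mathbb Z/2^{[n\text{ even}]}(n-1)\cdot 2(n-4)!\;\oplus\;\bigl(\mathbb Z/(n-2)(n-1)\cdot 2(n-4)!\bigr)^{(n^2-5n+2)/2}. \end{aligned} \] Moreover, for distinct $p,q\in\{1,\dots,n\}$ let $\langle p,q\rangle$ be the polytabloid of the $\lambda$-tableau whose second column is $(p,q)$ from top to bottom and whose first column is increasing from top to bottom, and let $\langle p,q\rangle\rho^+$ be formed with this tableau. There is a list $(b_i,c_i)$, $1\le i\le\binom{n-3}2-1$, with $b_i,c_i\in[2,n-2]$, $b_i<c_i$, $(b_i,c_i)\ne(2,3)$, such that $i<j$ implies $c_i>c_j$, or $c_i=c_j$ and $b_i>b_j$; fix such a list. Let $m=n(n-3)/2$ and \[ \begin{aligned} y_i&=\langle n-i,n\rangle &&(1\le i\le n-2),\\ y_{(n-2)+i}&=\langle n-1-i,n-1\rangle &&(1\le i\le n-3),\\ y_{(2n-5)+i}&=\langle b_i,c_i\rangle &&(1\le i\le\tbinom{n-3}2-1),\\ x_i&=(-1)^{n-i}\langle 1,n-1\rangle+\langle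 n-i,n-1\rangle &&(2\le i\le n-2),\\ x_{(n-2)+i}&=\langle n-1-i,n-1\rangle\rho^+ &&(2\le i\le n-3),\\ x_{(2n-5)+i}&=\langle b_i,c_i\rangle\rho^+ &&(1\le i\le\tbinom{n-3}2-1). \end{aligned} \] Put $z=\langle 3,n\rangle+(-1)^n\langle n-1,n\rangle-(n-3)\langle 3,n-1\rangle$. If $n$ is odd, let $x_1=\langle 3,4\rangle$ and $x_{n-1}=\frac{n-3}2\langle n-2,n-1\rangle\rho^+-\frac{n-1}2z$. If $n$ is even, let $x_1=\langle 3,n\rangle+\frac{n-2}2\langle 3,4\rangle$ and $x_{n-1}=\langle n-2,n-1\rangle\rho^++z$. Then $(x_1,\dots,x_m)$ and $(y_1,\dots,y_m)$ are $\mathbb Z$-linear bases of $S^\lambda$ that trigonalize the form, in the following sense: $(x_i,y_i)\ne0$ for all $i$; $(x_i,y_j)=0$ for $i>j$; $(x_i,y_i)$ divides $(x_i,y_j)$ for $i<j$; $(x_i,y_i)$ divides $(x_{i+1},y_{i+1})$ for $i<m$; and $\prod_i(x_i,y_i)=\pm\det G$, where $G$ is the Gram matrix of $(-,-)$ on $S^\lambda$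 with respect to any $\mathbb Z$-basis. The elementary divisors of $G$ are $(x_1,y_1),\dots,(x_m,y_m)$ (up to sign), i.e. $S^{\lambda,*}/S^\lambda\cong\bigoplus_{i=1}^m\mathbb Z/(x_i,y_i)\mathbb Z$. -/

import Mathlib

noncomputable section

namespace SpechtGram

/-- The set `[1, n]` of letters permuted by the symmetric group `S_n`. -/
abbrev Letter (n : ℕ) : Type := {k : ℕ // k ∈ Finset.Icc 1 n}

/-- A tableau of shape `μ`: a bijective filling of the cells of `μ` (cell `(i, j)` is in row `i`
and column `j`, counted from `0`) with the numbers `1, …, n`. -/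
abbrev Tableau (μ : YoungDiagram) (n : ℕ) : Type := {c : ℕ × ℕ // c ∈ μ.cells} ≃ Letter n

variable {μ : YoungDiagram} {n : ℕ}

/-- The row containing the letter `k`. -/
def Tableau.row (a : Tableau μ n) (k : Letter n) : ℕ := (a.symm k).1.1

/-- The column containing the letter `k`. -/
def Tableau.col (a : Tableau μ n) (k : Letter n) : ℕ := (a.symm k).1.2

/-- Entrywise (right) operation of `S_n` on tableaux. -/
def Tableau.act (a : Tableau μ n) (σ : Equiv.Perm (Letter n)) : Tableau μ n := a.trans σ

/-- Two tableaux are row equivalent if their rows coincide as unordered sets. -/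
def rowSetoid (μ : YoungDiagram) (n : ℕ) : Setoid (Tableau μ n) where
  r a b := ∀ k, Tableau.row a k = Tableau.row b k
  iseqv := ⟨fun _ _ => rfl, fun h k => (h k).symm, fun h h' k => (h k).trans (h' k)⟩

/-- Tabloids: tableaux with unordered rows. -/
def Tabloid (μ : YoungDiagram) (n : ℕ) : Type := Quotient (rowSetoid μ n)

/-- The tabloid `{a}` of a tableau `[a]`. -/
def tabloid (a : Tableau μ n) : Tabloid μ n := Quotient.mk (rowSetoid μ n) a

/-- Operation of `S_n` on tabloids, `{a} σ = {a σ}`. -/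
def Tabloid.act (σ : Equiv.Perm (Letter n)) : Tabloid μ n → Tabloid μ n :=
  Quotient.map' (s₁ := rowSetoid μ n) (s₂ := rowSetoid μ n) (fun a => Tableau.act a σ)
    (fun _ _ h k => h (σ.symm k))

/-- `M^μ`, the free `ℤ`-module on the set of tabloids. -/
abbrev TabloidModule (μ : YoungDiagram) (n : ℕ) : Type := Tabloid μ n →₀ ℤ

/-- The operation of `σ ∈ S_n` on `M^μ`. -/
def TabloidModule.act (μ : YoungDiagram) (σ : Equiv.Perm (Letter n)) :
    TabloidModule μ n →ₗ[ℤ] TabloidModule μ n :=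
  Finsupp.lmapDomain ℤ ℤ (Tabloid.act σ)

/-- The bilinear form on `M^μ` for which the tabloids are orthonormal. -/
def tabloidForm (μ : YoungDiagram) (n : ℕ) : LinearMap.BilinForm ℤ (TabloidModule μ n) :=
  Finsupp.linearCombination ℤ
    (fun t => (Finsupp.lapply t : TabloidModule μ n →ₗ[ℤ] ℤ))

open Classical in
theorem tabloidForm_single (s t : Tabloid μ n) :
    tabloidForm μ n (Finsupp.single s 1) (Finsupp.single t 1) = if s = t then 1 else 0 := by
  simp [tabloidForm, Finsupp.single_apply, eq_comm]

/-- The column stabilizer `C_a` of `[a]`. -/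
def colStabilizer (a : Tableau μ n) : Finset (Equiv.Perm (Letter n)) :=
  Finset.univ.filter fun σ => ∀ k, Tableau.col a (σ k) = Tableau.col a k

/-- The row stabilizer `R_a` of `[a]`. -/
def rowStabilizer (a : Tableau μ n) : Finset (Equiv.Perm (Letter n)) :=
  Finset.univ.filter fun σ => ∀ k, Tableau.row a (σ k) = Tableau.row a k

/-- The polytabloid `⟨a⟩ = ∑_{σ ∈ C_a} {a} σ ε_σ` in `M^μ`. -/
def polytabloidM (a : Tableau μ n) : TabloidModule μ n :=
  ∑ σ ∈ colStabilizer a,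
    (Equiv.Perm.sign σ : ℤ) • TabloidModule.act μ σ (Finsupp.single (tabloid a) 1)

/-- The Specht module `S^μ`: the `ℤ`-span of the polytabloids. -/
def Specht (μ : YoungDiagram) (n : ℕ) : Submodule ℤ (TabloidModule μ n) :=
  Submodule.span ℤ (Set.range polytabloidM)

theorem act_single (σ : Equiv.Perm (Letter n)) (a : Tableau μ n) :
    TabloidModule.act μ σ (Finsupp.single (tabloid a) 1)
      = Finsupp.single (tabloid (Tableau.act a σ)) 1 := by
  simp only [TabloidModule.act, Finsupp.lmapDomain_apply, Finsupp.mapDomain_single]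
  rfl

theorem act_polytabloidM (σ : Equiv.Perm (Letter n)) (a : Tableau μ n) :
    TabloidModule.act μ σ (polytabloidM a) = polytabloidM (Tableau.act a σ) := by
  unfold polytabloidM
  rw [map_sum]
  refine Finset.sum_bij' (fun τ _ => σ * τ * σ⁻¹) (fun τ _ => σ⁻¹ * τ * σ) ?_ ?_ ?_ ?_ ?_
  · intro τ hτ
    simp only [colStabilizer, Finset.mem_filter, Finset.mem_univ, true_and] at hτ ⊢
    intro k
    have := hτ (σ.symm k)
    simpa [Tableau.col, Tableau.act] using this
  · intro τ hτ
    simp only [colStabilizer, Finset.mem_filter, Finset.mem_univ, true_and] at hτ ⊢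
    intro k
    have := hτ (σ k)
    simpa [Tableau.col, Tableau.act] using this
  · intro τ _; group
  · intro τ _; group
  · intro τ _
    rw [map_smul, act_single, act_single, act_single]
    have h1 : Equiv.Perm.sign (σ * τ * σ⁻¹) = Equiv.Perm.sign τ := by
      rw [map_mul, map_mul, map_inv, mul_right_comm, mul_inv_cancel, one_mul]
    have h2 : Tableau.act (Tableau.act a τ) σ
        = Tableau.act (Tableau.act a σ) (σ * τ * σ⁻¹) := by
      ext c
      simp [Tableau.act]
    rw [h1, h2]

theorem act_mem_specht (σ : Equiv.Perm (Letter n)) :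
    ∀ v ∈ Specht μ n, TabloidModule.act μ σ v ∈ Specht μ n := by
  intro v hv
  induction hv using Submodule.span_induction with
  | mem x hx =>
    obtain ⟨a, rfl⟩ := hx
    rw [act_polytabloidM]
    exact Submodule.subset_span ⟨_, rfl⟩
  | zero => simp
  | add x y _ _ hx hy => rw [map_add]; exact Submodule.add_mem _ hx hy
  | smul c x _ hx => rw [map_smul]; exact Submodule.smul_mem _ c hx

/-- The operation of `σ ∈ S_n` on the Specht module. -/
def Specht.act (μ : YoungDiagram) (σ : Equiv.Perm (Letter n)) : Specht μ n →ₗ[ℤ] Specht μ n :=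
  (TabloidModule.act μ σ).restrict (act_mem_specht σ)

/-- The invariant bilinear form on the Specht module. -/
def spechtForm (μ : YoungDiagram) (n : ℕ) : LinearMap.BilinForm ℤ (Specht μ n) :=
  (tabloidForm μ n).restrict (Specht μ n)

/-- For a bilinear form on `X`, the cokernel of `X → X^*`, `ξ ↦ (ξ, -)`. -/
abbrev FormCokernel {X : Type*} [AddCommGroup X] (B : LinearMap.BilinForm ℤ X) : Type _ :=
  Module.Dual ℤ X ⧸ LinearMap.range B

/-- The polytabloid `⟨a⟩` as an element of the Specht module. -/
def polytabloid (a : Tableau μ n) : Specht μ n :=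
  ⟨polytabloidM a, Submodule.subset_span ⟨a, rfl⟩⟩

/-- The element `⟨a⟩ ρ_a⁺ = ∑_{σ ∈ R_a} ⟨a⟩ σ`. -/
def polytabloidRho (a : Tableau μ n) : Specht μ n :=
  ∑ σ ∈ rowStabilizer a, Specht.act μ σ (polytabloid a)

/-- The partition `(2², 1^{n-4})` (for `n ≥ 4`). -/
def shape (n : ℕ) : YoungDiagram :=
  YoungDiagram.ofRowLens (2 :: 2 :: List.replicate (n - 4) 1) (by
    simp only [List.sortedGE_iff_pairwise, List.pairwise_cons, List.mem_cons, List.mem_replicate,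
      List.pairwise_replicate]
    refine ⟨?_, ?_, ?_⟩
    · rintro b (rfl | ⟨_, rfl⟩) <;> norm_num
    · rintro b ⟨_, rfl⟩; norm_num
    · simp)

theorem mem_shape (hn : 4 ≤ n) (c : ℕ × ℕ) :
    c ∈ (shape n).cells ↔ (c.2 = 0 ∧ c.1 < n - 2) ∨ (c.2 = 1 ∧ c.1 < 2) := by
  obtain ⟨i, j⟩ := c
  rw [YoungDiagram.mem_cells, shape, YoungDiagram.mem_ofRowLens]
  rcases i with _ | _ | i
  · simp; omega
  · simp; omega
  · simp; omega

theorem card_compl {p q : ℕ} (hp : p ∈ Finset.Icc 1 n) (hq : q ∈ Finset.Icc 1 n) (hpq : p ≠ q) :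
    (Finset.Icc 1 n \ {p, q}).card = n - 2 := by
  rw [Finset.card_sdiff_of_subset, Finset.card_pair hpq]
  · simp
  · intro z hz
    simp only [Finset.mem_insert, Finset.mem_singleton] at hz
    rcases hz with rfl | rfl <;> assumption

/-- The filling of `(2², 1^{n-4})` with second column `(p, q)` from top to bottom, whose first
column lists the remaining letters increasingly from top to bottom. -/
def columnFilling (hn : 4 ≤ n) (p q : Letter n) (hpq : p.1 ≠ q.1)
    (c : {c : ℕ × ℕ // c ∈ (shape n).cells}) : Letter n :=
  if h : c.1.2 = 0 then
    ⟨(Finset.Icc 1 n \ {p.1, q.1}).orderEmbOfFin (card_compl p.2 q.2 hpq)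
        ⟨c.1.1, by have := (mem_shape hn c.1).1 c.2; omega⟩,
      (Finset.mem_sdiff.1 (Finset.orderEmbOfFin_mem _ _ _)).1⟩
  else if c.1.1 = 0 then p else q

theorem columnFilling_bijective (hn : 4 ≤ n) (p q : Letter n) (hpq : p.1 ≠ q.1) :
    Function.Bijective (columnFilling hn p q hpq) := by
  have key : ∀ i, ((Finset.Icc 1 n \ {p.1, q.1}).orderEmbOfFin (card_compl p.2 q.2 hpq) i) ≠ p.1 ∧
      ((Finset.Icc 1 n \ {p.1, q.1}).orderEmbOfFin (card_compl p.2 q.2 hpq) i) ≠ q.1 := by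
    intro i
    have := (Finset.mem_sdiff.1 (Finset.orderEmbOfFin_mem (Finset.Icc 1 n \ {p.1, q.1})
      (card_compl p.2 q.2 hpq) i)).2
    simpa using this
  constructor
  · rintro ⟨⟨i, j⟩, hc⟩ ⟨⟨i', j'⟩, hc'⟩ h
    have h1 := (mem_shape hn _).1 hc
    have h2 := (mem_shape hn _).1 hc'
    have h' := congrArg Subtype.val h
    simp only [columnFilling] at h' h1 h2
    split_ifs at h' with e1 e2 e3 e4 e5 e6 e7
    all_goals first
      | (exact absurd h' (key _).1)
      | (exact absurd h' (key _).2)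
      | (exact absurd h'.symm (key _).1)
      | (exact absurd h'.symm (key _).2)
      | (exact absurd h' hpq)
      | (exact absurd h'.symm hpq)
      | skip
    · have h3 := congrArg Fin.val
        (((Finset.Icc 1 n \ {p.1, q.1}).orderEmbOfFin (card_compl p.2 q.2 hpq)).injective h')
      simp only at h3
      simp [h3, e1, e2]
    all_goals
      simp only [Subtype.mk.injEq, Prod.mk.injEq]
      omega
  · intro z
    by_cases hz : z.1 = p.1
    · refine ⟨⟨(0, 1), (mem_shape hn _).2 (by simp)⟩, ?_⟩
      simp [columnFilling, Subtype.ext_iff, hz]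
    by_cases hz' : z.1 = q.1
    · refine ⟨⟨(1, 1), (mem_shape hn _).2 (by simp)⟩, ?_⟩
      simp [columnFilling, Subtype.ext_iff, hz']
    have hmem : z.1 ∈ Set.range
        ((Finset.Icc 1 n \ {p.1, q.1}).orderEmbOfFin (card_compl p.2 q.2 hpq)) := by
      rw [Finset.range_orderEmbOfFin]
      have := z.2
      simp only [Finset.coe_sdiff, Set.mem_sdiff, Finset.mem_coe]
      refine ⟨this, ?_⟩
      simp [hz, hz']
    obtain ⟨i, hi⟩ := hmem
    refine ⟨⟨(i.1, 0), (mem_shape hn _).2 (by simp)⟩, ?_⟩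
    apply Subtype.ext
    simp [columnFilling, hi]

/-- The tableau of shape `(2², 1^{n-4})` with second column `(p, q)` and increasing first column. -/
def columnTableau (hn : 4 ≤ n) (p q : Letter n) (hpq : p.1 ≠ q.1) : Tableau (shape n) n :=
  Equiv.ofBijective _ (columnFilling_bijective hn p q hpq)

/-- `p` and `q` are distinct elements of `[1, n]`, and `n ≥ 4`. -/
def ValidPair (n p q : ℕ) : Prop := 4 ≤ n ∧ p ∈ Finset.Icc 1 n ∧ q ∈ Finset.Icc 1 n ∧ p ≠ q

open Classical in
/-- The polytabloid with second column `(p, q)` and increasing first column, for distinct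
`p, q ∈ [1, n]` and `n ≥ 4`; it is only used for such arguments. -/
def pt (n p q : ℕ) : Specht (shape n) n :=
  if h : ValidPair n p q then
    polytabloid (columnTableau h.1 ⟨p, h.2.1⟩ ⟨q, h.2.2.1⟩ h.2.2.2)
  else 0

open Classical in
/-- The element `⟨a⟩ ρ_a⁺` for the tableau `[a]` with second column `(p, q)` and increasing first
column, for distinct `p, q ∈ [1, n]` and `n ≥ 4`; it is only used for such arguments. -/
def ptRho (n p q : ℕ) : Specht (shape n) n :=
  if h : ValidPair n p q then
    polytabloidRho (columnTableau h.1 ⟨p, h.2.1⟩ ⟨q, h.2.2.1⟩ h.2.2.2)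
  else 0

/-- `(b_i, c_i)`, `i ∈ [1, binom(n-3, 2) - 1]`, is the list of the pairs `b < c` in `[2, n-2]`
different from `(2, 3)`, ordered such that `i < j` implies `c_i > c_j`, or `c_i = c_j` and
`b_i > b_j`. -/
structure IsPairList (n : ℕ) (b c : ℕ → ℕ) : Prop where
  mem : ∀ i ∈ Finset.Icc 1 ((n - 3).choose 2 - 1),
    b i ∈ Finset.Icc 2 (n - 2) ∧ c i ∈ Finset.Icc 2 (n - 2) ∧ b i < c i ∧ (b i, c i) ≠ (2, 3)
  order : ∀ i ∈ Finset.Icc 1 ((n - 3).choose 2 - 1), ∀ j ∈ Finset.Icc 1 ((n - 3).choose 2 - 1),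
    i < j → c j < c i ∨ (c i = c j ∧ b j < b i)

/-- The tuple `y`, with indices `i ∈ [1, n(n-3)/2]`. -/
def yTuple (n : ℕ) (b c : ℕ → ℕ) (i : ℕ) : Specht (shape n) n :=
  if i ≤ n - 2 then pt n (n - i) n
  else if i ≤ 2 * n - 5 then pt n (n - 1 - (i - (n - 2))) (n - 1)
  else pt n (b (i - (2 * n - 5))) (c (i - (2 * n - 5)))

/-- The element `⟨3, n⟩ + (-1)^n ⟨n-1, n⟩ - (n-3) ⟨3, n-1⟩`. -/
def zElement (n : ℕ) : Specht (shape n) n :=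
  pt n 3 n + (-1 : ℤ) ^ n • pt n (n - 1) n - ((n - 3 : ℕ) : ℤ) • pt n 3 (n - 1)

/-- The tuple `x`, with indices `i ∈ [1, n(n-3)/2]`. -/
def xTuple (n : ℕ) (b c : ℕ → ℕ) (i : ℕ) : Specht (shape n) n :=
  if i = 1 then
    if Odd n then pt n 3 4
    else pt n 3 n + (((n - 2) / 2 : ℕ) : ℤ) • pt n 3 4
  else if i ≤ n - 2 then
    (-1 : ℤ) ^ (n - i) • pt n 1 (n - 1) + pt n (n - i) (n - 1)
  else if i = (n - 2) + 1 then
    if Odd n then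
      (((n - 3) / 2 : ℕ) : ℤ) • ptRho n (n - 2) (n - 1) - (((n - 1) / 2 : ℕ) : ℤ) • zElement n
    else ptRho n (n - 2) (n - 1) + zElement n
  else if i ≤ 2 * n - 5 then ptRho n (n - 1 - (i - (n - 2))) (n - 1)
  else ptRho n (b (i - (2 * n - 5))) (c (i - (2 * n - 5)))

/-- The tuples `x` and `y` are `ℤ`-linear bases of `X` that trigonalize the bilinear form `B`, the
diagonal values being the elementary divisors of the Gram matrix of `B`. -/
structure AreTrigonalizingBases {X : Type*} [AddCommGroup X] (B : LinearMap.BilinForm ℤ X)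
    {m : ℕ} (x y : Fin m → X) : Prop where
  indep_x : LinearIndependent ℤ x
  span_x : Submodule.span ℤ (Set.range x) = ⊤
  indep_y : LinearIndependent ℤ y
  span_y : Submodule.span ℤ (Set.range y) = ⊤
  diag_ne_zero : ∀ i, B (x i) (y i) ≠ 0
  lower_eq_zero : ∀ i j, j < i → B (x i) (y j) = 0
  diag_dvd_upper : ∀ i j, i < j → B (x i) (y i) ∣ B (x i) (y j)
  diag_dvd_diag : ∀ i j : Fin m, (j : ℕ) = (i : ℕ) + 1 → B (x i) (y i) ∣ B (x j) (y j)
  prod_diag : ∀ e : Module.Basis (Fin m) ℤ X,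
    ∏ i, B (x i) (y i) = (Matrix.of fun i j => B (e i) (e j)).det ∨
    ∏ i, B (x i) (y i) = -(Matrix.of fun i j => B (e i) (e j)).det
  elementary_divisors :
    Nonempty (FormCokernel B ≃+ ((i : Fin m) → ZMod (B (x i) (y i)).natAbs))

end SpechtGram

end

/-! A polytabloid depends, up to sign, only on the set {p, q} of entries of its second column.
Normalizing the sign gives vectors v_pq (`pairVector`) indexed by the edges of the complete graph on
1, …, n, on which a permutation acts by moving the edge and multiplying by its sign. Two kinds of
relations hold: the edges at a fixed vertex sum to zero (`sum_letter_pairVector`), and all edges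
together sum to zero (`sum_sum_pairVector`). Over ℤ the second is only half of the sum of the first,
and this factor 2 matters for spanning.

The form is invariant under S_n, so its value on two edges depends only on whether they coincide,
share one vertex or are disjoint. The first value is the order of the column stabilizer, and the
vertex relations determine the other two. After division by 2(n-4)! the value is 2 - (n-1)A +
(n-1)(n-2)I, where A counts incidences of endpoints and I tests equality of edges
(`spechtForm_pairVector`).

The vector ⟨p,q⟩ρ⁺ is, up to sign, an alternating sum over a 4-cycle through 1, p, q and one further
vertex (`ptRho_eq`). In such a sum the constant and the incidence terms cancel, so its values are
multiples of (n-1)(n-2), and against the edges used in y only one edge besides {p, q} is detected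
(`pairForm_cycleSum`). Hence most of the matrix of values (x_i, y_j) is triangular with that
diagonal. The first n-1 vectors of x are built so that their diagonal values supply the smaller
divisors; z serves to vanish on y_1, …, y_{n-2}.

Both tuples generate the lattice: in the quotient by a submodule containing the tuple, the edges
become a function g satisfying the edge relations. For y, all edges vanish except those in the
triangle 1, 2, 3 and those at 1, and the relations dispose of the rest. For x, the vanishing
4-cycles make g constant on three families of edges, leaving a small linear system that is solvable
by integer combinations (`eq_top_of_xTuple_mem`).

Finally, each diagonal value divides its row, so the matrix of values is a diagonal matrix times a
unitriangular one. This gives the cokernel, the determinant up to sign and the linear independence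
at once (`areTrigonalizingBases_of_span`). -/

noncomputable section

namespace SpechtGram

/-! ### Polytabloids of arbitrary shape: signs, invariance and norms -/

section General

variable {μ : YoungDiagram} {n : ℕ}

theorem perm_apply_inv {α : Type*} (σ : Equiv.Perm α) (k : α) : σ (σ⁻¹ k) = k :=
  σ.apply_symm_apply k

theorem perm_inv_apply {α : Type*} (σ : Equiv.Perm α) (k : α) : σ⁻¹ (σ k) = k :=
  σ.symm_apply_apply k

theorem mem_colStabilizer {a : Tableau μ n} {σ : Equiv.Perm (Letter n)} :
    σ ∈ colStabilizer a ↔ ∀ k, Tableau.col a (σ k) = Tableau.col a k := by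
  simp [colStabilizer]

theorem mem_rowStabilizer {a : Tableau μ n} {σ : Equiv.Perm (Letter n)} :
    σ ∈ rowStabilizer a ↔ ∀ k, Tableau.row a (σ k) = Tableau.row a k := by
  simp [rowStabilizer]

theorem Tableau.act_act (a : Tableau μ n) (σ τ : Equiv.Perm (Letter n)) :
    Tableau.act (Tableau.act a σ) τ = Tableau.act a (τ * σ) := by
  ext c
  simp [Tableau.act]

theorem Tableau.col_act (a : Tableau μ n) (σ : Equiv.Perm (Letter n)) (k : Letter n) :
    Tableau.col (Tableau.act a σ) k = Tableau.col a (σ⁻¹ k) := rfl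

theorem Tableau.row_act (a : Tableau μ n) (σ : Equiv.Perm (Letter n)) (k : Letter n) :
    Tableau.row (Tableau.act a σ) k = Tableau.row a (σ⁻¹ k) := rfl

/-- Column-stabilizing permutations operate on the polytabloid by their sign. -/
theorem polytabloidM_act_of_mem {a : Tableau μ n} {σ : Equiv.Perm (Letter n)}
    (hσ : σ ∈ colStabilizer a) :
    polytabloidM (Tableau.act a σ) = (Equiv.Perm.sign σ : ℤ) • polytabloidM a := by
  rw [← act_polytabloidM]
  unfold polytabloidM
  rw [map_sum, Finset.smul_sum]
  have hσ' := mem_colStabilizer.1 hσ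
  refine Finset.sum_bij' (fun τ _ => σ * τ) (fun τ _ => σ⁻¹ * τ) ?_ ?_ ?_ ?_ ?_
  · intro τ hτ
    rw [mem_colStabilizer] at hτ ⊢
    intro k
    rw [Equiv.Perm.mul_apply, hσ', hτ]
  · intro τ hτ
    rw [mem_colStabilizer] at hτ ⊢
    intro k
    rw [← hσ', Equiv.Perm.mul_apply, perm_apply_inv, hτ]
  · intro τ _; group
  · intro τ _; group
  · intro τ _
    rw [map_smul, act_single, act_single, act_single, Tableau.act_act, map_mul, smul_smul]
    congr 1
    rw [Units.val_mul, ← mul_assoc, ← Units.val_mul, Int.units_mul_self, Units.val_one, one_mul]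

/-- Pairing with a tabloid reads off its coefficient. -/
theorem tabloidForm_single_left (t : Tabloid μ n) (w : TabloidModule μ n) :
    tabloidForm μ n (Finsupp.single t 1) w = w t := by
  simp [tabloidForm]

theorem Tabloid.act_injective (σ : Equiv.Perm (Letter n)) :
    Function.Injective (Tabloid.act (μ := μ) σ) := by
  intro s t
  induction s using Quotient.inductionOn with | _ a =>
  induction t using Quotient.inductionOn with | _ b =>
  intro h
  have h1 : ∀ k, Tableau.row (Tableau.act a σ) k = Tableau.row (Tableau.act b σ) k :=
    Quotient.exact h
  refine Quotient.sound fun k => ?_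
  simpa [Tableau.row_act] using h1 (σ k)

theorem TabloidModule.act_apply (σ : Equiv.Perm (Letter n)) (v : TabloidModule μ n)
    (t : Tabloid μ n) : TabloidModule.act μ σ v (Tabloid.act σ t) = v t :=
  Finsupp.mapDomain_apply (Tabloid.act_injective σ) v t

theorem tabloidForm_act (σ : Equiv.Perm (Letter n)) (v w : TabloidModule μ n) :
    tabloidForm μ n (TabloidModule.act μ σ v) (TabloidModule.act μ σ w) = tabloidForm μ n v w := by
  induction v using Finsupp.induction_linear with
  | zero => simp
  | add v v' h h' => simp only [map_add, LinearMap.add_apply, h, h']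
  | single t c =>
    have : Finsupp.single t c = c • Finsupp.single t (1 : ℤ) := by simp
    rw [this, map_smul, map_smul, map_smul, LinearMap.smul_apply, LinearMap.smul_apply,
      tabloidForm_single_left]
    have h2 : TabloidModule.act μ σ (Finsupp.single t 1) = Finsupp.single (Tabloid.act σ t) 1 := by
      simp [TabloidModule.act]
    rw [h2, tabloidForm_single_left, TabloidModule.act_apply]

/-- A column permutation keeps the column of each letter, and the tabloid records the row; together
they locate the cell. Hence the terms of a polytabloid do not collapse, and its norm is the order of
the column stabilizer. -/
theorem tabloid_act_eq_iff {a : Tableau μ n} {σ τ : Equiv.Perm (Letter n)}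
    (hσ : σ ∈ colStabilizer a) (hτ : τ ∈ colStabilizer a) :
    tabloid (Tableau.act a σ) = tabloid (Tableau.act a τ) ↔ σ = τ := by
  refine ⟨fun h => ?_, fun h => h ▸ rfl⟩
  have h1 : ∀ k, Tableau.row (Tableau.act a σ) k = Tableau.row (Tableau.act a τ) k :=
    Quotient.exact h
  rw [mem_colStabilizer] at hσ hτ
  apply inv_injective
  ext k : 1
  apply a.symm.injective
  apply Subtype.ext
  refine Prod.ext (h1 k) ?_
  have e1 := hσ (σ⁻¹ k)
  have e2 := hτ (τ⁻¹ k)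
  rw [perm_apply_inv] at e1 e2
  exact e1.symm.trans e2

theorem tabloidForm_polytabloidM_self (a : Tableau μ n) :
    tabloidForm μ n (polytabloidM a) (polytabloidM a) = (colStabilizer a).card := by
  classical
  unfold polytabloidM
  simp only [act_single, map_sum, map_smul, LinearMap.sum_apply, LinearMap.smul_apply,
    tabloidForm_single]
  rw [Finset.cast_card]
  refine Finset.sum_congr rfl fun σ hσ => ?_
  rw [Finset.sum_eq_single σ]
  · simp [← Units.val_mul]
  · intro τ hτ hne
    rw [if_neg]
    · simp
    · rw [tabloid_act_eq_iff hτ hσ]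
      exact hne
  · exact fun h => absurd hσ h

/-- The column stabilizer is the stabilizer of the colouring of letters by columns, hence a product
of symmetric groups on the colour classes. -/
theorem card_colStabilizer_eq_prod (a : Tableau μ n) (N : ℕ) (hN : ∀ k, Tableau.col a k < N) :
    (colStabilizer a).card =
      ∏ i : Fin N, (Fintype.card {k : Letter n // Tableau.col a k = i}).factorial := by
  classical
  have h := DomMulAct.stabilizer_card (fun k : Letter n => (⟨Tableau.col a k, hN k⟩ : Fin N))
  simp only [Fin.ext_iff] at h
  rw [← h, Fintype.card_subtype]
  congr 1
  ext σ
  simp [mem_colStabilizer, funext_iff]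

/-- A permutation moving one tableau into another. -/
def Tableau.diff (a b : Tableau μ n) : Equiv.Perm (Letter n) := a.symm.trans b

theorem Tableau.act_diff (a b : Tableau μ n) : Tableau.act a (Tableau.diff a b) = b := by
  ext c
  simp [Tableau.act, Tableau.diff]

theorem Tableau.diff_act (a b : Tableau μ n) (σ : Equiv.Perm (Letter n)) :
    Tableau.diff a (Tableau.act b σ) = σ * Tableau.diff a b := rfl

theorem Tableau.diff_trans (a b c : Tableau μ n) :
    Tableau.diff b c * Tableau.diff a b = Tableau.diff a c := by
  ext k
  simp [Tableau.diff]

/-- The polytabloid of `[b]`, normalized by the sign of the permutation moving `[a]` to `[b]`. -/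
def signedPolytabloid (a b : Tableau μ n) : Specht μ n :=
  (Equiv.Perm.sign (Tableau.diff a b) : ℤ) • polytabloid b

theorem act_polytabloid (σ : Equiv.Perm (Letter n)) (a : Tableau μ n) :
    Specht.act μ σ (polytabloid a) = polytabloid (Tableau.act a σ) :=
  Subtype.ext (act_polytabloidM σ a)

theorem polytabloid_act_of_mem {a : Tableau μ n} {σ : Equiv.Perm (Letter n)}
    (hσ : σ ∈ colStabilizer a) :
    polytabloid (Tableau.act a σ) = (Equiv.Perm.sign σ : ℤ) • polytabloid a :=
  Subtype.ext (polytabloidM_act_of_mem hσ)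

theorem act_signedPolytabloid (σ : Equiv.Perm (Letter n)) (a b : Tableau μ n) :
    Specht.act μ σ (signedPolytabloid a b)
      = (Equiv.Perm.sign σ : ℤ) • signedPolytabloid a (Tableau.act b σ) := by
  unfold signedPolytabloid
  rw [map_smul, act_polytabloid, Tableau.diff_act, map_mul, smul_smul, Units.val_mul, ← mul_assoc,
    ← Units.val_mul, Int.units_mul_self, Units.val_one, one_mul]

/-- The tableaux differ by a column permutation. Its sign enters once through the polytabloid and
once through the normalization, and the two cancel. -/
theorem signedPolytabloid_congr (a : Tableau μ n) {b b' : Tableau μ n}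
    (h : ∀ k, Tableau.col b k = Tableau.col b' k) :
    signedPolytabloid a b = signedPolytabloid a b' := by
  have hm : Tableau.diff b b' ∈ colStabilizer b := by
    rw [mem_colStabilizer]
    intro k
    rw [h]
    simp [Tableau.col, Tableau.diff]
  have h1 := polytabloid_act_of_mem hm
  rw [Tableau.act_diff] at h1
  unfold signedPolytabloid
  rw [h1, smul_smul, ← Tableau.diff_trans a b b', map_mul, Units.val_mul,
    mul_comm (Units.val (Equiv.Perm.sign (Tableau.diff b b'))), mul_assoc, ← Units.val_mul,
    Int.units_mul_self, Units.val_one, mul_one]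

theorem spechtForm_act (σ : Equiv.Perm (Letter n)) (v w : Specht μ n) :
    spechtForm μ n (Specht.act μ σ v) (Specht.act μ σ w) = spechtForm μ n v w :=
  tabloidForm_act σ v.1 w.1

theorem spechtForm_polytabloid_self (a : Tableau μ n) :
    spechtForm μ n (polytabloid a) (polytabloid a) = (colStabilizer a).card :=
  tabloidForm_polytabloidM_self a

theorem span_range_polytabloid :
    Submodule.span ℤ (Set.range (polytabloid : Tableau μ n → Specht μ n)) = ⊤ := by
  have h := Submodule.span_span_coe_preimage (R := ℤ)
    (s := Set.range (polytabloidM : Tableau μ n → TabloidModule μ n))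
  refine Eq.trans ?_ h
  congr 1
  ext v
  simp only [Set.mem_range, polytabloid, Subtype.ext_iff]
  rfl

/-- The row of a tabloid containing the letter `k`. -/
def Tabloid.row (t : Tabloid μ n) (k : Letter n) : ℕ :=
  Quotient.liftOn t (fun a => Tableau.row a k) (fun _ _ h => h k)

theorem exists_of_polytabloidM_apply_ne_zero {a : Tableau μ n} {t : Tabloid μ n}
    (h : polytabloidM a t ≠ 0) :
    ∃ σ ∈ colStabilizer a, ∀ k, Tabloid.row t (σ k) = Tableau.row a k := by
  classical
  unfold polytabloidM at h
  rw [Finsupp.finsetSum_apply] at h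
  obtain ⟨σ, hσ, hne⟩ := Finset.exists_ne_zero_of_sum_ne_zero h
  refine ⟨σ, hσ, fun k => ?_⟩
  rw [act_single, Finsupp.smul_apply, Finsupp.single_apply] at hne
  split_ifs at hne with e
  · rw [← e]
    change Tableau.row (Tableau.act a σ) (σ k) = _
    rw [Tableau.row_act, perm_inv_apply]
  · simp at hne

theorem Tabloid.act_eq_self {t : Tabloid μ n} {σ : Equiv.Perm (Letter n)}
    (h : ∀ k, Tabloid.row t (σ k) = Tabloid.row t k) : Tabloid.act σ t = t := by
  induction t using Quotient.inductionOn with | _ a =>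
  refine Quotient.sound fun k => ?_
  rw [Tableau.row_act]
  have := h (σ⁻¹ k)
  rw [perm_apply_inv] at this
  exact this.symm

end General

variable {n : ℕ}

/-! ### Tableaux of shape (2², 1^{n-4}) and the sign of their second column -/

section ColumnTableau

variable (hn : 4 ≤ n)

/-- The cell in row `i` of the first column. -/
def cellLeft {i : ℕ} (hi : i < n - 2) : {c : ℕ × ℕ // c ∈ (shape n).cells} :=
  ⟨(i, 0), (mem_shape hn _).2 (Or.inl ⟨rfl, hi⟩)⟩

/-- The cell in row `i` of the second column. -/
def cellRight {i : ℕ} (hi : i < 2) : {c : ℕ × ℕ // c ∈ (shape n).cells} :=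
  ⟨(i, 1), (mem_shape hn _).2 (Or.inr ⟨rfl, hi⟩)⟩

theorem cell_cases (c : {c : ℕ × ℕ // c ∈ (shape n).cells}) :
    (∃ i, ∃ hi : i < n - 2, c = cellLeft hn hi) ∨ (∃ i, ∃ hi : i < 2, c = cellRight hn hi) := by
  obtain ⟨⟨i, j⟩, hc⟩ := c
  rcases (mem_shape hn _).1 hc with ⟨h, h'⟩ | ⟨h, h'⟩
  · simp only at h h'
    subst h
    exact Or.inl ⟨i, h', rfl⟩
  · simp only at h h'
    subst h
    exact Or.inr ⟨i, h', rfl⟩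

variable (p q : Letter n) (hpq : p.1 ≠ q.1)

theorem columnTableau_cellRight_zero : columnTableau hn p q hpq (cellRight hn zero_lt_two) = p := by
  simp [columnTableau, columnFilling, cellRight]

theorem columnTableau_cellRight_one : columnTableau hn p q hpq (cellRight hn one_lt_two) = q := by
  simp [columnTableau, columnFilling, cellRight]

theorem columnTableau_cellLeft {i : ℕ} (hi : i < n - 2) :
    (columnTableau hn p q hpq (cellLeft hn hi)).1 =
      (Finset.Icc 1 n \ {p.1, q.1}).orderEmbOfFin (card_compl p.2 q.2 hpq) ⟨i, hi⟩ := by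
  simp [columnTableau, columnFilling, cellLeft]

theorem columnTableau_cellLeft_ne {i : ℕ} (hi : i < n - 2) :
    columnTableau hn p q hpq (cellLeft hn hi) ≠ p ∧
      columnTableau hn p q hpq (cellLeft hn hi) ≠ q := by
  have := (Finset.mem_sdiff.1 (Finset.orderEmbOfFin_mem (Finset.Icc 1 n \ {p.1, q.1})
      (card_compl p.2 q.2 hpq) ⟨i, hi⟩)).2
  rw [← columnTableau_cellLeft hn p q hpq hi] at this
  simpa [← Subtype.ext_iff] using this

theorem col_columnTableau (k : Letter n) :
    Tableau.col (columnTableau hn p q hpq) k = if k = p ∨ k = q then 1 else 0 := by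
  obtain ⟨c, rfl⟩ := (columnTableau hn p q hpq).surjective k
  have h0 : Tableau.col (columnTableau hn p q hpq) (columnTableau hn p q hpq c) = c.1.2 := by
    simp [Tableau.col]
  rw [h0]
  rcases cell_cases hn c with ⟨i, hi, rfl⟩ | ⟨i, hi, rfl⟩
  · have := columnTableau_cellLeft_ne hn p q hpq hi
    rw [if_neg (by tauto)]
    rfl
  · rw [if_pos]
    · rfl
    · interval_cases i
      · exact Or.inl (columnTableau_cellRight_zero ..)
      · exact Or.inr (columnTableau_cellRight_one ..)

theorem row_columnTableau_left : Tableau.row (columnTableau hn p q hpq) p = 0 := by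
  have : (columnTableau hn p q hpq).symm p = cellRight hn zero_lt_two := by
    rw [Equiv.symm_apply_eq, columnTableau_cellRight_zero]
  simp only [Tableau.row, this]
  rfl

theorem row_columnTableau_right : Tableau.row (columnTableau hn p q hpq) q = 1 := by
  have : (columnTableau hn p q hpq).symm q = cellRight hn one_lt_two := by
    rw [Equiv.symm_apply_eq, columnTableau_cellRight_one]
  simp only [Tableau.row, this]
  rfl

/-- Letter permutations that increase off the second column move column tableaux to each other. -/
theorem act_columnTableau (σ : Equiv.Perm (Letter n))
    (hσ : ∀ k l : Letter n, k ≠ p → k ≠ q → l ≠ p → l ≠ q → k < l → σ k < σ l)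
    (hpq' : (σ p).1 ≠ (σ q).1) :
    Tableau.act (columnTableau hn p q hpq) σ = columnTableau hn (σ p) (σ q) hpq' := by
  refine Equiv.ext fun c => ?_
  rcases cell_cases hn c with ⟨i, hi, rfl⟩ | ⟨i, hi, rfl⟩
  · apply Subtype.ext
    rw [columnTableau_cellLeft]
    have h := Finset.orderEmbOfFin_unique (card_compl (σ p).2 (σ q).2 hpq')
      (f := fun j : Fin (n - 2) => (σ (columnTableau hn p q hpq (cellLeft hn j.2))).1) ?_ ?_
    · exact congrFun h ⟨i, hi⟩
    · intro j
      have h2 := columnTableau_cellLeft_ne hn p q hpq j.2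
      rw [Finset.mem_sdiff]
      refine ⟨Subtype.property _, ?_⟩
      simp only [Finset.mem_insert, Finset.mem_singleton, ← Subtype.ext_iff,
        EmbeddingLike.apply_eq_iff_eq]
      tauto
    · intro j j' hj
      have h2 := columnTableau_cellLeft_ne hn p q hpq j.2
      have h3 := columnTableau_cellLeft_ne hn p q hpq j'.2
      refine hσ _ _ h2.1 h2.2 h3.1 h3.2 ?_
      rw [← Subtype.coe_lt_coe, columnTableau_cellLeft, columnTableau_cellLeft]
      exact (Finset.orderEmbOfFin _ _).strictMono hj
  · interval_cases i
    · rw [columnTableau_cellRight_zero, Tableau.act, Equiv.trans_apply,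
        columnTableau_cellRight_zero]
    · rw [columnTableau_cellRight_one, Tableau.act, Equiv.trans_apply,
        columnTableau_cellRight_one]

theorem act_swap_columnTableau :
    Tableau.act (columnTableau hn p q hpq) (Equiv.swap p q) = columnTableau hn q p hpq.symm := by
  have hpq' : (Equiv.swap p q p).1 ≠ (Equiv.swap p q q).1 := by simpa using hpq.symm
  rw [act_columnTableau hn p q hpq (Equiv.swap p q) _ hpq']
  · congr 1 <;> simp
  · intro k l h1 h2 h3 h4 h
    rwa [Equiv.swap_apply_of_ne_of_ne h1 h2, Equiv.swap_apply_of_ne_of_ne h3 h4]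

theorem act_swap_succ_columnTableau_right (q' : Letter n) (hq : q'.1 = q.1 + 1)
    (hpq' : p.1 ≠ q'.1) :
    Tableau.act (columnTableau hn p q hpq) (Equiv.swap q q') = columnTableau hn p q' hpq' := by
  have hp : Equiv.swap q q' p = p :=
    Equiv.swap_apply_of_ne_of_ne (fun h => hpq (congrArg _ h)) (fun h => hpq' (congrArg _ h))
  have h' : (Equiv.swap q q' p).1 ≠ (Equiv.swap q q' q).1 := by simpa [hp] using hpq'
  rw [act_columnTableau hn p q hpq (Equiv.swap q q') _ h']
  · congr 1; simp
  · intro k l h1 h2 h3 h4 h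
    rw [← Subtype.coe_lt_coe] at h ⊢
    rw [ne_eq, Subtype.ext_iff] at h2 h4
    simp only [Equiv.swap_apply_def, Subtype.ext_iff]
    split_ifs <;> omega

theorem exists_letter {k : ℕ} (h : k ∈ Finset.Icc 1 n) : ∃ p : Letter n, p.1 = k := ⟨⟨k, h⟩, rfl⟩

/-- The sign of the permutation moving the tableau with second column `(1, 2)` to `[b]`. -/
def tableauSign (b : Tableau (shape n) n) : ℤˣ :=
  Equiv.Perm.sign (Tableau.diff (columnTableau hn ⟨1, by simp; omega⟩ ⟨2, by simp; omega⟩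
    (by simp)) b)

theorem tableauSign_act (b : Tableau (shape n) n) (σ : Equiv.Perm (Letter n)) :
    tableauSign hn (Tableau.act b σ) = Equiv.Perm.sign σ * tableauSign hn b := by
  rw [tableauSign, Tableau.diff_act, map_mul, tableauSign]

theorem tableauSign_swap :
    tableauSign hn (columnTableau hn q p hpq.symm) = - tableauSign hn (columnTableau hn p q hpq) := by
  rw [← act_swap_columnTableau, tableauSign_act, Equiv.Perm.sign_swap, neg_one_mul]
  exact fun h => hpq (congrArg _ h)

theorem tableauSign_succ_right (q' : Letter n) (hq : q'.1 = q.1 + 1) (hpq' : p.1 ≠ q'.1) :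
    tableauSign hn (columnTableau hn p q' hpq')
      = - tableauSign hn (columnTableau hn p q hpq) := by
  rw [← act_swap_succ_columnTableau_right hn p q hpq q' hq, tableauSign_act,
    Equiv.Perm.sign_swap, neg_one_mul]
  rintro rfl
  omega

theorem tableauSign_one_right (r : ℕ) (hr : r + 2 ∈ Finset.Icc 1 n) (h1 : 1 ∈ Finset.Icc 1 n) :
    tableauSign hn (columnTableau hn ⟨1, h1⟩ ⟨r + 2, hr⟩ (by simp)) = (-1) ^ r := by
  induction r with
  | zero =>
    have : Tableau.diff (columnTableau hn ⟨1, h1⟩ ⟨2, hr⟩ (by simp))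
      (columnTableau hn ⟨1, h1⟩ ⟨2, hr⟩ (by simp)) = 1 := by
      ext k; simp [Tableau.diff]
    simp [tableauSign, this]
  | succ r ih =>
    have hr' : r + 2 ∈ Finset.Icc 1 n := by simp at hr ⊢; omega
    rw [tableauSign_succ_right hn ⟨1, h1⟩ ⟨r + 2, hr'⟩ (by simp) _ rfl, ih hr', pow_succ, mul_neg_one]

/-- Increasing an entry of the second column by one is an adjacent transposition, which keeps the
first column increasing and flips the sign. The step lemma moves the bottom entry only, so the
induction on `p` first exchanges the two entries and then exchanges them back. -/
theorem tableauSign_columnTableau (h : p.1 < q.1) :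
    tableauSign hn (columnTableau hn p q hpq) = (-1) ^ (p.1 + q.1 + 1) := by
  obtain ⟨p, hp⟩ := p
  obtain ⟨q, hq⟩ := q
  simp only at h hpq ⊢
  obtain ⟨p, rfl⟩ : ∃ p', p = p' + 1 := ⟨p - 1, by simp at hp; omega⟩
  induction p with
  | zero =>
    obtain ⟨r, rfl⟩ : ∃ r, q = r + 2 := ⟨q - 2, by omega⟩
    rw [tableauSign_one_right]
    simp only [pow_add]
    simp
  | succ p ih =>
    have hp' : p + 1 ∈ Finset.Icc 1 n := by simp at hp ⊢; omega
    rw [← neg_inj, ← tableauSign_swap hn _ _ (by simpa using hpq),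
      tableauSign_succ_right hn ⟨q, hq⟩ ⟨p + 1, hp'⟩ (by simp; omega) ⟨p + 1 + 1, hp⟩ rfl,
      tableauSign_swap hn ⟨p + 1, hp'⟩ ⟨q, hq⟩ (by simp; omega), ih hp' (by simp; omega) (by omega)]
    simp only [pow_add]
    simp

end ColumnTableau

/-! ### Normalized polytabloids as edges of a complete graph, and their relations -/

open Classical in
/-- The polytabloid with second column `{p, q}`, normalized so that it is symmetric in `p, q`. -/
def pairVector (n p q : ℕ) : Specht (shape n) n :=
  if h : ValidPair n p q then
    (tableauSign h.1 (columnTableau h.1 ⟨p, h.2.1⟩ ⟨q, h.2.2.1⟩ h.2.2.2) : ℤ) •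
      polytabloid (columnTableau h.1 ⟨p, h.2.1⟩ ⟨q, h.2.2.1⟩ h.2.2.2)
  else 0

theorem pairVector_of_valid {p q : ℕ} (h : ValidPair n p q) :
    pairVector n p q =
      (tableauSign h.1 (columnTableau h.1 ⟨p, h.2.1⟩ ⟨q, h.2.2.1⟩ h.2.2.2) : ℤ) •
        polytabloid (columnTableau h.1 ⟨p, h.2.1⟩ ⟨q, h.2.2.1⟩ h.2.2.2) := dif_pos h

theorem pairVector_coe (hn : 4 ≤ n) (p q : Letter n) (hpq : p.1 ≠ q.1) :
    pairVector n p q = (tableauSign hn (columnTableau hn p q hpq) : ℤ) •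
      polytabloid (columnTableau hn p q hpq) :=
  pairVector_of_valid ⟨hn, p.2, q.2, hpq⟩

theorem pairVector_self (n p : ℕ) : pairVector n p p = 0 := dif_neg fun h => h.2.2.2 rfl

theorem ValidPair.symm {p q : ℕ} (h : ValidPair n p q) : ValidPair n q p :=
  ⟨h.1, h.2.2.1, h.2.1, h.2.2.2.symm⟩

theorem tableauSign_smul_polytabloid_congr (hn : 4 ≤ n) {a b : Tableau (shape n) n}
    (h : ∀ k, Tableau.col a k = Tableau.col b k) :
    (tableauSign hn a : ℤ) • polytabloid a = (tableauSign hn b : ℤ) • polytabloid b :=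
  signedPolytabloid_congr _ h

theorem pairVector_comm (n p q : ℕ) : pairVector n p q = pairVector n q p := by
  by_cases h : ValidPair n p q
  · rw [pairVector_of_valid h, pairVector_of_valid h.symm]
    refine tableauSign_smul_polytabloid_congr h.1 fun k => ?_
    rw [col_columnTableau, col_columnTableau]
    simp only [or_comm]
  · rw [pairVector, pairVector, dif_neg h, dif_neg fun h' => h h'.symm]

theorem act_pairVector (hn : 4 ≤ n) (σ : Equiv.Perm (Letter n)) (p q : Letter n) :
    Specht.act (shape n) σ (pairVector n p q) =
      (Equiv.Perm.sign σ : ℤ) • pairVector n (σ p) (σ q) := by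
  by_cases hpq : p = q
  · subst hpq
    simp [pairVector_self]
  have hpq1 : p.1 ≠ q.1 := fun h => hpq (Subtype.ext h)
  have hpq2 : (σ p).1 ≠ (σ q).1 := fun h => hpq (σ.injective (Subtype.ext h))
  rw [pairVector_coe hn p q hpq1, pairVector_coe hn _ _ hpq2]
  have := act_signedPolytabloid σ (columnTableau hn ⟨1, by simp; omega⟩ ⟨2, by simp; omega⟩
    (by simp)) (columnTableau hn p q hpq1)
  refine this.trans ?_
  congr 1
  refine signedPolytabloid_congr _ fun k => ?_
  rw [Tableau.col_act, col_columnTableau, col_columnTableau]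
  simp only [Equiv.Perm.inv_eq_iff_eq]

/-- `pt` is `pairVector` up to an explicit sign. -/
theorem pt_eq {p q : ℕ} (h : ValidPair n p q) (hlt : p < q) :
    pt n p q = (-1 : ℤ) ^ (p + q + 1) • pairVector n p q := by
  rw [pairVector_of_valid h, tableauSign_columnTableau _ _ _ _ hlt, pt, dif_pos h, smul_smul]
  rw [Units.val_pow_eq_pow_val, Units.val_neg, Units.val_one, ← pow_add, Even.neg_one_pow ⟨_, rfl⟩,
    one_smul]

theorem exists_columnTableau (hn : 4 ≤ n) (a : Tableau (shape n) n) :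
    ∃ p q : Letter n, ∃ hpq : p.1 ≠ q.1,
      ∀ k, Tableau.col a k = Tableau.col (columnTableau hn p q hpq) k := by
  have hne : (a (cellRight hn zero_lt_two)).1 ≠ (a (cellRight hn one_lt_two)).1 := by
    intro h
    have := a.injective (Subtype.ext h)
    simp [cellRight] at this
  refine ⟨_, _, hne, fun k => ?_⟩
  obtain ⟨c, rfl⟩ := a.surjective k
  rw [col_columnTableau]
  simp only [Tableau.col, Equiv.symm_apply_apply, EmbeddingLike.apply_eq_iff_eq]
  rcases cell_cases hn c with ⟨i, hi, rfl⟩ | ⟨i, hi, rfl⟩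
  · simp [cellLeft, cellRight]
  · interval_cases i <;> simp [cellRight]

/-- Every tableau has the same columns as some column tableau, so its polytabloid is an edge vector
up to sign. -/
theorem span_pairVector (hn : 4 ≤ n) (W : Submodule ℤ (Specht (shape n) n))
    (hW : ∀ p ∈ Finset.Icc 1 n, ∀ q ∈ Finset.Icc 1 n, p < q → pairVector n p q ∈ W) : W = ⊤ := by
  rw [eq_top_iff, ← span_range_polytabloid, Submodule.span_le]
  rintro _ ⟨a, rfl⟩
  obtain ⟨p, q, hpq, h⟩ := exists_columnTableau hn a
  have h1 := tableauSign_smul_polytabloid_congr hn h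
  rw [← pairVector_coe] at h1
  have h2 : polytabloid a = (tableauSign hn a : ℤ) • pairVector n p q := by
    rw [← h1, smul_smul, ← Units.val_mul, Int.units_mul_self, Units.val_one, one_smul]
  rw [h2]
  refine W.smul_mem _ ?_
  rcases lt_or_gt_of_ne hpq with h3 | h3
  · exact hW _ p.2 _ q.2 h3
  · rw [pairVector_comm]
    exact hW _ q.2 _ p.2 h3

theorem tabloid_row_mk (a : Tableau (shape n) n) (k : Letter n) :
    Tabloid.row (Quotient.mk (rowSetoid (shape n) n) a) k = Tableau.row a k := rfl

/-- A column permutation can only fix or exchange `p` and `q`, so in every tabloid that occurs these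
letters fill one place in each of the top two rows. -/
theorem pairVector_apply_ne_zero (hn : 4 ≤ n) {p q : Letter n} {t : Tabloid (shape n) n}
    (h : (pairVector n p q).1 t ≠ 0) :
    Tabloid.row t p < 2 ∧ Tabloid.row t q < 2 ∧ Tabloid.row t p ≠ Tabloid.row t q := by
  by_cases hpq : p = q
  · subst hpq
    simp [pairVector_self] at h
  have hpq1 : p.1 ≠ q.1 := fun h => hpq (Subtype.ext h)
  rw [pairVector_coe hn p q hpq1] at h
  have h' : polytabloidM (columnTableau hn p q hpq1) t ≠ 0 := by
    intro h0
    apply h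
    change (_ : ℤ) • polytabloidM (columnTableau hn p q hpq1) t = 0
    rw [h0, smul_zero]
  obtain ⟨σ, hσ, hr⟩ := exists_of_polytabloidM_apply_ne_zero h'
  have hp := hr p
  have hq := hr q
  rw [row_columnTableau_left] at hp
  rw [row_columnTableau_right] at hq
  rw [mem_colStabilizer] at hσ
  have h1 := hσ p
  have h2 := hσ q
  have h3 : σ p ≠ σ q := fun h => hpq (σ.injective h)
  simp only [col_columnTableau, true_or, or_true, if_true] at h1 h2
  have h1' : σ p = p ∨ σ p = q := by
    by_contra h; rw [if_neg h] at h1; exact zero_ne_one h1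
  have h2' : σ q = p ∨ σ q = q := by
    by_contra h; rw [if_neg h] at h2; exact zero_ne_one h2
  rcases h1' with e | e <;> rcases h2' with e' | e' <;> rw [e] at hp h3 <;> rw [e'] at hq h3
  · exact absurd rfl h3
  · omega
  · omega
  · exact absurd rfl h3

theorem exists_row_eq (hn : 4 ≤ n) (t : Tabloid (shape n) n) (r : ℕ) (hr : r < 2) :
    ∃ c d : Letter n, c ≠ d ∧ ∀ k, Tabloid.row t k = r ↔ k = c ∨ k = d := by
  induction t using Quotient.inductionOn with | _ a =>
  have hr' : r < n - 2 := by omega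
  refine ⟨a (cellLeft hn hr'), a (cellRight hn hr), ?_, fun k => ?_⟩
  · intro h
    have := a.injective h
    simp [cellLeft, cellRight] at this
  · obtain ⟨c, rfl⟩ := a.surjective k
    rw [tabloid_row_mk]
    simp only [Tableau.row, Equiv.symm_apply_apply, EmbeddingLike.apply_eq_iff_eq]
    rcases cell_cases hn c with ⟨i, hi, rfl⟩ | ⟨i, hi, rfl⟩ <;> simp [cellLeft, cellRight]

/-- The star relation: the normalized polytabloids with a fixed letter in the second column sum
to zero. -/
theorem sum_letter_pairVector (hn : 4 ≤ n) (p : Letter n) :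
    ∑ q : Letter n, pairVector n p q = 0 := by
  apply Subtype.ext
  rw [AddSubmonoidClass.coe_finsetSum]
  ext t
  rw [Finsupp.finsetSum_apply]
  change _ = (0 : ℤ)
  by_cases hp : Tabloid.row t p < 2
  · obtain ⟨c, d, hcd, h⟩ := exists_row_eq hn t (1 - Tabloid.row t p) (by omega)
    have hp' : p ≠ c ∧ p ≠ d := by
      have := h p
      constructor
      · rintro rfl; simp at this; omega
      · rintro rfl; simp at this; omega
    -- Here `c` and `d` form the other one of the two rows of length two; no other `q` contributes
    -- to the coefficient of `t`. The transposition of `c` and `d` fixes `t` and is odd, so the two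
    -- remaining coefficients are opposite.
    rw [← Finset.sum_subset (Finset.subset_univ {c, d}), Finset.sum_pair hcd]
    · have h1 := act_pairVector hn (Equiv.swap c d) p c
      rw [Equiv.swap_apply_left, Equiv.swap_apply_of_ne_of_ne hp'.1 hp'.2,
        Equiv.Perm.sign_swap hcd] at h1
      have h2 : Tabloid.act (Equiv.swap c d) t = t := by
        apply Tabloid.act_eq_self
        intro k
        have hc := (h c).2 (Or.inl rfl)
        have hd := (h d).2 (Or.inr rfl)
        rw [Equiv.swap_apply_def]
        split_ifs with e e
        · rw [e, hc, hd]
        · rw [e, hc, hd]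
        · rfl
      have h3 := TabloidModule.act_apply (Equiv.swap c d) (pairVector n p c).1 t
      rw [h2] at h3
      have h4 := congrArg (fun v : Specht (shape n) n => v.1 t) h1
      change TabloidModule.act (shape n) (Equiv.swap c d) (pairVector n p c).1 t =
        (-1 : ℤ) • (pairVector n p d).1 t at h4
      rw [h3] at h4
      rw [h4]
      simp
    · intro q _ hq
      by_contra h0
      have := pairVector_apply_ne_zero hn h0
      apply hq
      simp only [Finset.mem_insert, Finset.mem_singleton]
      rw [← h]
      omega
  · refine Finset.sum_eq_zero fun q _ => ?_
    by_contra h0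
    exact hp (pairVector_apply_ne_zero hn h0).1

theorem sum_letter {M : Type*} [AddCommMonoid M] (f : ℕ → M) :
    ∑ q : Letter n, f q = ∑ q ∈ Finset.Icc 1 n, f q :=
  Finset.sum_coe_sort (Finset.Icc 1 n) f

theorem sum_pairVector (hn : 4 ≤ n) {p : ℕ} (hp : p ∈ Finset.Icc 1 n) :
    ∑ q ∈ Finset.Icc 1 n, pairVector n p q = 0 := by
  rw [← sum_letter]
  exact sum_letter_pairVector hn ⟨p, hp⟩

theorem sum_Icc_Ico_comm {M : Type*} [AddCommMonoid M] (f : ℕ → ℕ → M) (n : ℕ) :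
    ∑ p ∈ Finset.Icc 1 n, ∑ q ∈ Finset.Ico 1 p, f p q =
      ∑ q ∈ Finset.Icc 1 n, ∑ p ∈ Finset.Ioc q n, f p q := by
  refine Finset.sum_comm' fun p q => ?_
  simp only [Finset.mem_Icc, Finset.mem_Ico, Finset.mem_Ioc]
  omega

/-- Adding all vertex relations counts every edge twice, and the Specht module is torsion-free. In a
quotient module this relation no longer follows from the vertex relations, so it is carried along
separately. -/
theorem sum_sum_pairVector (hn : 4 ≤ n) :
    ∑ p ∈ Finset.Icc 1 n, ∑ q ∈ Finset.Ico 1 p, pairVector n p q = 0 := by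
  have h : ∑ p ∈ Finset.Icc 1 n, ∑ q ∈ Finset.Icc 1 n, pairVector n p q = 0 :=
    Finset.sum_eq_zero fun p hp => sum_pairVector hn hp
  have h1 : ∀ p ∈ Finset.Icc 1 n, ∑ q ∈ Finset.Icc 1 n, pairVector n p q =
      ∑ q ∈ Finset.Ico 1 p, pairVector n p q + ∑ q ∈ Finset.Ioc p n, pairVector n q p := by
    intro p hp
    rw [Finset.mem_Icc] at hp
    have e : Finset.Icc 1 n = (Finset.Ico 1 p ∪ Finset.Ioc p n) ∪ {p} := by
      ext k; simp only [Finset.mem_Icc, Finset.mem_union, Finset.mem_Ico, Finset.mem_Ioc,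
        Finset.mem_singleton]; omega
    rw [e, Finset.sum_union, Finset.sum_union, Finset.sum_singleton, pairVector_self, add_zero]
    · simp only [pairVector_comm n p]
    · rw [Finset.disjoint_left]; intro k; simp only [Finset.mem_Ico, Finset.mem_Ioc]; omega
    · rw [Finset.disjoint_left]; intro k
      simp only [Finset.mem_union, Finset.mem_Ico, Finset.mem_Ioc, Finset.mem_singleton]; omega
  rw [Finset.sum_congr rfl h1, Finset.sum_add_distrib, ← sum_Icc_Ico_comm, ← two_smul ℤ] at h
  exact (smul_eq_zero.1 h).resolve_left two_ne_zero

/-! ### Gram values of the edge vectors -/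

theorem card_letter (n : ℕ) : Fintype.card (Letter n) = n := by simp [Letter]

theorem card_colStabilizer_columnTableau (hn : 4 ≤ n) (p q : Letter n) (hpq : p.1 ≠ q.1) :
    (colStabilizer (columnTableau hn p q hpq)).card = 2 * (n - 2).factorial := by
  have hlt : ∀ k, Tableau.col (columnTableau hn p q hpq) k < 2 := by
    intro k
    rw [col_columnTableau]
    split_ifs <;> omega
  have hne : p ≠ q := fun h => hpq (congrArg _ h)
  have h1 : Fintype.card {k : Letter n // Tableau.col (columnTableau hn p q hpq) k = 1} = 2 := by
    have e : (Finset.univ.filter fun k : Letter n =>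
        Tableau.col (columnTableau hn p q hpq) k = 1) = {p, q} := by
      ext k
      simp [col_columnTableau, or_iff_not_imp_left]
    rw [Fintype.card_subtype, e, Finset.card_pair hne]
  have h0 : Fintype.card {k : Letter n // Tableau.col (columnTableau hn p q hpq) k = 0}
      = n - 2 := by
    have e : (Finset.univ.filter fun k : Letter n =>
        Tableau.col (columnTableau hn p q hpq) k = 0) = {p, q}ᶜ := by
      ext k
      simp only [col_columnTableau, Finset.mem_filter, Finset.mem_univ, true_and,
        Finset.mem_compl, Finset.mem_insert, Finset.mem_singleton]
      split_ifs with e <;> simp [e]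
    rw [Fintype.card_subtype, e, Finset.card_compl, Finset.card_pair hne, card_letter]
  rw [card_colStabilizer_eq_prod _ 2 hlt, Fin.prod_univ_two, Fin.val_zero, Fin.val_one, h0, h1]
  rw [mul_comm]
  rfl

theorem spechtForm_pairVector_self (hn : 4 ≤ n) (p q : Letter n) (hpq : p ≠ q) :
    spechtForm (shape n) n (pairVector n p q) (pairVector n p q) = 2 * (n - 2).factorial := by
  have hpq1 : p.1 ≠ q.1 := fun h => hpq (Subtype.ext h)
  rw [pairVector_coe hn p q hpq1, map_smul, map_smul, LinearMap.smul_apply, smul_smul,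
    ← Units.val_mul, Int.units_mul_self, Units.val_one, one_smul, spechtForm_polytabloid_self,
    card_colStabilizer_columnTableau]
  push_cast
  rfl

theorem spechtForm_pairVector_perm (hn : 4 ≤ n) (σ : Equiv.Perm (Letter n)) (p q r s : Letter n) :
    spechtForm (shape n) n (pairVector n (σ p) (σ q)) (pairVector n (σ r) (σ s)) =
      spechtForm (shape n) n (pairVector n p q) (pairVector n r s) := by
  rw [← spechtForm_act σ (pairVector n p q), act_pairVector hn, act_pairVector hn, map_smul,
    map_smul, LinearMap.smul_apply, smul_smul, ← Units.val_mul, Int.units_mul_self, Units.val_one,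
    one_smul]

theorem sum_eq_of_eq_off (g : Letter n → ℤ) (S : Finset (Letter n)) (c : ℤ)
    (h : ∀ q ∉ S, g q = c) : ∑ q, g q = ∑ q ∈ S, (g q - c) + n * c := by
  rw [Finset.sum_subset (Finset.subset_univ S), Finset.sum_sub_distrib, Finset.sum_const,
    Finset.card_univ, card_letter]
  · simp
  · intro q _ hq
    rw [h q hq, sub_self]

theorem sum_spechtForm_pairVector (hn : 4 ≤ n) (p : Letter n) (v : Specht (shape n) n) :
    ∑ q : Letter n, spechtForm (shape n) n (pairVector n p q) v = 0 := by
  rw [← LinearMap.sum_apply, ← map_sum, sum_letter_pairVector hn, map_zero, LinearMap.zero_apply]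

/-- Pair the vertex relation at `r` with v_rs. The edge `{r, s}` contributes its norm, and the n-2
other edges contribute equally, since transposing their far endpoints preserves the form and fixes
`r` and `s`. -/
theorem spechtForm_pairVector_of_share (hn : 4 ≤ n) (r s q : Letter n) (hrs : r ≠ s) (hqr : q ≠ r)
    (hqs : q ≠ s) :
    (n - 2) * spechtForm (shape n) n (pairVector n r q) (pairVector n r s) =
      - (2 * (n - 2).factorial) := by
  have h := sum_eq_of_eq_off
    (fun q => spechtForm (shape n) n (pairVector n r q) (pairVector n r s)) {r, s}
    (spechtForm (shape n) n (pairVector n r q) (pairVector n r s)) ?_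
  · rw [sum_spechtForm_pairVector hn, Finset.sum_pair hrs, pairVector_self,
      spechtForm_pairVector_self hn r s hrs, map_zero, LinearMap.zero_apply] at h
    linarith
  · intro q' hq'
    simp only [Finset.mem_insert, Finset.mem_singleton, not_or] at hq'
    have h1 := spechtForm_pairVector_perm hn (Equiv.swap q q') r q r s
    rwa [Equiv.swap_apply_left, Equiv.swap_apply_of_ne_of_ne hqr.symm (Ne.symm hq'.1),
      Equiv.swap_apply_of_ne_of_ne hqs.symm (Ne.symm hq'.2)] at h1

/-- The same argument with the vertex relation at `p`: the edges to `r` and `s` share a vertex with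
`{r, s}`, and the n-3 remaining ones are disjoint from it and contribute equally. -/
theorem spechtForm_pairVector_of_disjoint (hn : 4 ≤ n) (p q r s : Letter n) (hpq : p ≠ q)
    (hrs : r ≠ s) (hpr : p ≠ r) (hps : p ≠ s) (hqr : q ≠ r) (hqs : q ≠ s) :
    (n - 3) * spechtForm (shape n) n (pairVector n p q) (pairVector n r s) =
      - (spechtForm (shape n) n (pairVector n p r) (pairVector n r s) +
        spechtForm (shape n) n (pairVector n p s) (pairVector n r s)) := by
  have h := sum_eq_of_eq_off
    (fun q => spechtForm (shape n) n (pairVector n p q) (pairVector n r s)) {p, r, s}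
    (spechtForm (shape n) n (pairVector n p q) (pairVector n r s)) ?_
  · rw [sum_spechtForm_pairVector hn, Finset.sum_insert (by simp [hpr, hps]),
      Finset.sum_pair hrs, pairVector_self, map_zero, LinearMap.zero_apply] at h
    linarith
  · intro q' hq'
    simp only [Finset.mem_insert, Finset.mem_singleton, not_or] at hq'
    have h1 := spechtForm_pairVector_perm hn (Equiv.swap q q') p q r s
    rwa [Equiv.swap_apply_left, Equiv.swap_apply_of_ne_of_ne hpq (Ne.symm hq'.1),
      Equiv.swap_apply_of_ne_of_ne hqs.symm (Ne.symm hq'.2.2),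
      Equiv.swap_apply_of_ne_of_ne hqr.symm (Ne.symm hq'.2.1)] at h1

/-- The Gram values of the normalized polytabloids, divided by `2 * (n - 4)!`. -/
def gramValue (n p q r s : ℕ) : ℤ :=
  2 - (n - 1) * ((if p = r then 1 else 0) + (if p = s then 1 else 0) + (if q = r then 1 else 0) +
      (if q = s then 1 else 0)) +
    (n - 1) * (n - 2) * ((if p = r ∧ q = s then 1 else 0) + (if p = s ∧ q = r then 1 else 0))

theorem factorial_sub_two (hn : 4 ≤ n) :
    ((n - 2).factorial : ℤ) = (n - 2) * (n - 3) * (n - 4).factorial := by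
  obtain ⟨m, rfl⟩ := Nat.exists_eq_add_of_le' hn
  have h1 : m + 4 - 2 = m + 2 := by omega
  have h2 : m + 4 - 4 = m := by omega
  rw [h1, h2, Nat.factorial_succ, Nat.factorial_succ]
  push_cast
  ring

theorem spechtForm_pairVector_share (hn : 4 ≤ n) (r s q : Letter n) (hrs : r ≠ s) (hqr : q ≠ r)
    (hqs : q ≠ s) :
    spechtForm (shape n) n (pairVector n r q) (pairVector n r s) =
      2 * (n - 4).factorial * (3 - n) := by
  have h := spechtForm_pairVector_of_share hn r s q hrs hqr hqs
  rw [factorial_sub_two hn] at h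
  have hn' : (n : ℤ) - 2 ≠ 0 := by omega
  apply mul_left_cancel₀ hn'
  rw [h]
  ring

theorem spechtForm_pairVector (hn : 4 ≤ n) {p q r s : ℕ} (hp : p ∈ Finset.Icc 1 n)
    (hq : q ∈ Finset.Icc 1 n) (hr : r ∈ Finset.Icc 1 n) (hs : s ∈ Finset.Icc 1 n)
    (hpq : p ≠ q) (hrs : r ≠ s) :
    spechtForm (shape n) n (pairVector n p q) (pairVector n r s) =
      2 * (n - 4).factorial * gramValue n p q r s := by
  obtain ⟨p, rfl⟩ := exists_letter hp
  obtain ⟨q, rfl⟩ := exists_letter hq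
  obtain ⟨r, rfl⟩ := exists_letter hr
  obtain ⟨s, rfl⟩ := exists_letter hs
  have hn' : (n : ℤ) - 3 ≠ 0 := by omega
  have hself := spechtForm_pairVector_self hn r s (fun h => hrs (congrArg _ h))
  rw [factorial_sub_two hn] at hself
  simp only [ne_eq, ← Subtype.ext_iff] at hpq hrs
  simp only [gramValue, ← Subtype.ext_iff]
  by_cases hpr : p = r
  · subst hpr
    by_cases hqs : q = s
    · subst hqs
      rw [hself]
      simp [-mul_eq_mul_left_iff, hpq, Ne.symm hpq]
      ring
    · rw [spechtForm_pairVector_share hn p s q hrs (Ne.symm hpq) hqs]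
      simp [-mul_eq_mul_left_iff, hrs, hqs, Ne.symm hpq]
      ring
  by_cases hps : p = s
  · subst hps
    by_cases hqr : q = r
    · subst hqr
      rw [pairVector_comm n p q, hself]
      simp [-mul_eq_mul_left_iff, hpq, Ne.symm hpq]
      ring
    · rw [pairVector_comm n r p, spechtForm_pairVector_share hn p r q hpr (Ne.symm hpq) hqr]
      simp [-mul_eq_mul_left_iff, hpr, hqr, Ne.symm hpq]
      ring
  by_cases hqr : q = r
  · subst hqr
    rw [pairVector_comm n p q, spechtForm_pairVector_share hn q s p hrs hpq hps]
    simp [-mul_eq_mul_left_iff, hrs, hps, hpr]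
    ring
  by_cases hqs : q = s
  · subst hqs
    rw [pairVector_comm n p q, pairVector_comm n r q,
      spechtForm_pairVector_share hn q r p hqr hpq hpr]
    simp [-mul_eq_mul_left_iff, hps, hpr, hqr]
    ring
  have h := spechtForm_pairVector_of_disjoint hn p q r s hpq hrs hpr hps hqr hqs
  rw [pairVector_comm n p r, spechtForm_pairVector_share hn r s p hrs hpr hps,
    pairVector_comm n p s, pairVector_comm n r s,
    spechtForm_pairVector_share hn s r p (Ne.symm hrs) hps hpr] at h
  apply mul_left_cancel₀ hn'
  rw [pairVector_comm n r s, h]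
  simp [-mul_eq_mul_left_iff, hps, hpr, hqr, hqs]
  ring

/-! ### Row symmetrization as an alternating sum over a 4-cycle -/

section Rho

variable (hn : 4 ≤ n) (a : Tableau (shape n) n)

theorem rowStabilizer_eq {i p j q : Letter n}
    (hi : a (cellLeft hn (show 0 < n - 2 by omega)) = i) (hp : a (cellRight hn zero_lt_two) = p)
    (hj : a (cellLeft hn (show 1 < n - 2 by omega)) = j) (hq : a (cellRight hn one_lt_two) = q) :
    rowStabilizer a = {1, Equiv.swap i p, Equiv.swap j q, Equiv.swap i p * Equiv.swap j q} := by
  have hrow : ∀ c, Tableau.row a (a c) = c.1.1 := fun c => by simp [Tableau.row]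
  have ri : Tableau.row a i = 0 := by rw [← hi, hrow]; rfl
  have rp : Tableau.row a p = 0 := by rw [← hp, hrow]; rfl
  have rj : Tableau.row a j = 1 := by rw [← hj, hrow]; rfl
  have rq : Tableau.row a q = 1 := by rw [← hq, hrow]; rfl
  have h0 : ∀ k, Tableau.row a k = 0 → k = i ∨ k = p := by
    intro k hk
    obtain ⟨c, rfl⟩ := a.surjective k
    rw [hrow] at hk
    rw [← hi, ← hp]
    simp only [EmbeddingLike.apply_eq_iff_eq]
    rcases cell_cases hn c with ⟨l, hl, rfl⟩ | ⟨l, hl, rfl⟩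
    · simp only [cellLeft] at hk ⊢; simp [hk]
    · simp only [cellRight] at hk ⊢; simp [hk]
  have h1 : ∀ k, Tableau.row a k = 1 → k = j ∨ k = q := by
    intro k hk
    obtain ⟨c, rfl⟩ := a.surjective k
    rw [hrow] at hk
    rw [← hj, ← hq]
    simp only [EmbeddingLike.apply_eq_iff_eq]
    rcases cell_cases hn c with ⟨l, hl, rfl⟩ | ⟨l, hl, rfl⟩
    · simp only [cellLeft] at hk ⊢; simp [hk]
    · simp only [cellRight] at hk ⊢; simp [hk]
  have h2 : ∀ k l, 2 ≤ Tableau.row a k → Tableau.row a l = Tableau.row a k → l = k := by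
    intro k l hk hl
    obtain ⟨c, rfl⟩ := a.surjective k
    obtain ⟨d, rfl⟩ := a.surjective l
    rw [hrow] at hk
    rw [hrow, hrow] at hl
    congr 1
    rcases cell_cases hn c with ⟨r, hr, rfl⟩ | ⟨r, hr, rfl⟩ <;>
    rcases cell_cases hn d with ⟨r', hr', rfl⟩ | ⟨r', hr', rfl⟩ <;>
    simp only [cellLeft, cellRight] at hk hl ⊢
    · simp [hl]
    all_goals omega
  have hip : i ≠ p := by rw [← hi, ← hp]; simp [cellLeft, cellRight]
  have hjq : j ≠ q := by rw [← hj, ← hq]; simp [cellLeft, cellRight]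
  have hij : i ≠ j := fun h => by rw [h, rj] at ri; omega
  have hiq : i ≠ q := fun h => by rw [h, rq] at ri; omega
  have hpj : p ≠ j := fun h => by rw [h, rj] at rp; omega
  have hpq : p ≠ q := fun h => by rw [h, rq] at rp; omega
  have hs1 : ∀ k, Tableau.row a (Equiv.swap i p k) = Tableau.row a k := by
    intro k
    rw [Equiv.swap_apply_def]
    split_ifs with e e
    · rw [e, ri, rp]
    · rw [e, ri, rp]
    · rfl
  have hs2 : ∀ k, Tableau.row a (Equiv.swap j q k) = Tableau.row a k := by
    intro k
    rw [Equiv.swap_apply_def]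
    split_ifs with e e
    · rw [e, rj, rq]
    · rw [e, rj, rq]
    · rfl
  ext σ
  rw [mem_rowStabilizer]
  simp only [Finset.mem_insert, Finset.mem_singleton]
  constructor
  · intro h
    -- Only the two top rows have more than one letter, so a row permutation is determined by its
    -- values at `i` and `j`; this leaves four possibilities.
    have key : ∀ τ : Equiv.Perm (Letter n), (∀ k, Tableau.row a (τ k) = Tableau.row a k) →
        σ i = τ i → σ j = τ j → σ = τ := by
      intro τ hτ ei ej
      ext k : 1
      by_cases k2 : 2 ≤ Tableau.row a k
      · rw [h2 k _ k2 (h k), h2 k _ k2 (hτ k)]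
      · by_cases k0 : Tableau.row a k = 0
        · rcases h0 k k0 with rfl | rfl
          · exact ei
          · have a1 := h0 _ ((h k).trans rp)
            have a2 := h0 _ ((h i).trans ri)
            have b1 := h0 _ ((hτ k).trans rp)
            have b2 := h0 _ ((hτ i).trans ri)
            have a3 : σ k ≠ σ i := fun e => hip (σ.injective e).symm
            have b3 : τ k ≠ τ i := fun e => hip (τ.injective e).symm
            grind
        · rcases h1 k (by omega) with rfl | rfl
          · exact ej
          · have a1 := h1 _ ((h k).trans rq)
            have a2 := h1 _ ((h j).trans rj)
            have b1 := h1 _ ((hτ k).trans rq)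
            have b2 := h1 _ ((hτ j).trans rj)
            have a3 : σ k ≠ σ j := fun e => hjq (σ.injective e).symm
            have b3 : τ k ≠ τ j := fun e => hjq (τ.injective e).symm
            grind
    have c1 := h0 _ ((h i).trans ri)
    have c2 := h1 _ ((h j).trans rj)
    have s1j : Equiv.swap i p j = j := Equiv.swap_apply_of_ne_of_ne hij.symm hpj.symm
    have s2i : Equiv.swap j q i = i := Equiv.swap_apply_of_ne_of_ne hij hiq
    have s1q : Equiv.swap i p q = q := Equiv.swap_apply_of_ne_of_ne hiq.symm hpq.symm
    rcases c1 with c1 | c1 <;> rcases c2 with c2 | c2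
    · exact Or.inl (key 1 (fun k => rfl) c1 c2)
    · exact Or.inr (Or.inr (Or.inl (key _ hs2 (by rw [c1, s2i])
        (by rw [c2, Equiv.swap_apply_left]))))
    · exact Or.inr (Or.inl (key _ hs1 (by rw [c1, Equiv.swap_apply_left]) (by rw [c2, s1j])))
    · refine Or.inr (Or.inr (Or.inr (key _ ?_ ?_ ?_)))
      · intro k; rw [Equiv.Perm.mul_apply, hs1, hs2]
      · rw [Equiv.Perm.mul_apply, s2i, Equiv.swap_apply_left, c1]
      · rw [Equiv.Perm.mul_apply, Equiv.swap_apply_left, s1q, c2]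
  · rintro (rfl | rfl | rfl | rfl) k
    · rfl
    · exact hs1 k
    · exact hs2 k
    · rw [Equiv.Perm.mul_apply, hs1, hs2]

/-- The two generating row transpositions are odd and the action on edges is twisted by the sign, so
symmetrizing over rows becomes antisymmetrizing in the endpoints. -/
theorem sum_rowStabilizer_act_pairVector {i p j q : Letter n}
    (hi : a (cellLeft hn (show 0 < n - 2 by omega)) = i) (hp : a (cellRight hn zero_lt_two) = p)
    (hj : a (cellLeft hn (show 1 < n - 2 by omega)) = j) (hq : a (cellRight hn one_lt_two) = q) :
    ∑ σ ∈ rowStabilizer a, Specht.act (shape n) σ (pairVector n p q) =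
      pairVector n p q - pairVector n i q - pairVector n p j + pairVector n i j := by
  rw [rowStabilizer_eq hn a hi hp hj hq]
  have hip : i ≠ p := by rw [← hi, ← hp]; simp [cellLeft, cellRight]
  have hjq : j ≠ q := by rw [← hj, ← hq]; simp [cellLeft, cellRight]
  have hij : i ≠ j := by rw [← hi, ← hj]; simp [cellLeft]
  have hiq : i ≠ q := by rw [← hi, ← hq]; simp [cellLeft, cellRight]
  have hpj : p ≠ j := by rw [← hp, ← hj]; simp [cellLeft, cellRight]
  have hpq : p ≠ q := by rw [← hp, ← hq]; simp [cellRight]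
  have s1q : Equiv.swap i p q = q := Equiv.swap_apply_of_ne_of_ne hiq.symm hpq.symm
  have s1j : Equiv.swap i p j = j := Equiv.swap_apply_of_ne_of_ne hij.symm hpj.symm
  have s2p : Equiv.swap j q p = p := Equiv.swap_apply_of_ne_of_ne hpj hpq
  have s1p : Equiv.swap i p p = i := Equiv.swap_apply_right ..
  have s2q : Equiv.swap j q q = j := Equiv.swap_apply_right ..
  have n1 : (1 : Equiv.Perm (Letter n)) ∉ ({Equiv.swap i p, Equiv.swap j q,
      Equiv.swap i p * Equiv.swap j q} : Finset (Equiv.Perm (Letter n))) := by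
    simp only [Finset.mem_insert, Finset.mem_singleton]
    rintro (h | h | h)
    · have := Equiv.congr_fun h p; rw [s1p] at this; exact hip this.symm
    · have := Equiv.congr_fun h q; rw [s2q] at this; exact hjq this.symm
    · have := Equiv.congr_fun h p; rw [Equiv.Perm.mul_apply, s2p, s1p] at this
      exact hip this.symm
  have n2 : Equiv.swap i p ∉ ({Equiv.swap j q,
      Equiv.swap i p * Equiv.swap j q} : Finset (Equiv.Perm (Letter n))) := by
    simp only [Finset.mem_insert, Finset.mem_singleton]
    rintro (h | h)
    · have := Equiv.congr_fun h p; rw [s1p, s2p] at this; exact hip this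
    · have := Equiv.congr_fun h q; rw [Equiv.Perm.mul_apply, s2q, s1q, s1j] at this
      exact hjq this.symm
  have n3 : Equiv.swap j q ≠ Equiv.swap i p * Equiv.swap j q := by
    intro h
    have := Equiv.congr_fun h p
    rw [Equiv.Perm.mul_apply, s2p, s1p] at this
    exact hip this.symm
  rw [Finset.sum_insert n1, Finset.sum_insert n2, Finset.sum_pair n3, act_pairVector hn,
    act_pairVector hn, act_pairVector hn, act_pairVector hn, map_mul, Equiv.Perm.sign_swap hip,
    Equiv.Perm.sign_swap hjq, map_one, Equiv.Perm.mul_apply, Equiv.Perm.mul_apply, s2p, s2q, s1p,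
    s1j, s1q, Equiv.Perm.one_apply, Equiv.Perm.one_apply]
  simp only [Units.val_one, Units.val_neg, one_smul, neg_smul, mul_neg, mul_one, neg_neg]
  abel

end Rho

/-- The second-smallest letter outside of `{p, q}`, for `2 ≤ p < q`, `(p, q) ≠ (2, 3)`. -/
def secondLetter (p : ℕ) : ℕ := if p = 2 then 3 else 2

theorem columnTableau_cellLeft_zero (hn : 4 ≤ n) (p q : Letter n) (hpq : p.1 ≠ q.1)
    (hp : 2 ≤ p.1) (hq : 2 ≤ q.1) :
    (columnTableau hn p q hpq (cellLeft hn (show 0 < n - 2 by omega))).1 = 1 := by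
  rw [columnTableau_cellLeft, Finset.orderEmbOfFin_zero]
  apply le_antisymm
  · apply Finset.min'_le
    simp
    omega
  · have := Finset.min'_mem (Finset.Icc 1 n \ {p.1, q.1})
      (Finset.card_pos.1 (by rw [card_compl p.2 q.2 hpq]; omega))
    simp only [Finset.mem_sdiff, Finset.mem_Icc] at this
    exact this.1.1

theorem columnTableau_cellLeft_one (hn : 4 ≤ n) (p q : Letter n) (hpq : p.1 ≠ q.1)
    (hp : 2 ≤ p.1) (hlt : p.1 < q.1) (hne : ¬ (p.1 = 2 ∧ q.1 = 3)) :
    (columnTableau hn p q hpq (cellLeft hn (show 1 < n - 2 by omega))).1 = secondLetter p := by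
  have h0 := columnTableau_cellLeft_zero hn p q hpq hp (by omega)
  rw [columnTableau_cellLeft] at h0 ⊢
  have hmem := Finset.orderEmbOfFin_mem (Finset.Icc 1 n \ {p.1, q.1})
    (card_compl p.2 q.2 hpq) ⟨1, by omega⟩
  have hlt' : (Finset.Icc 1 n \ {p.1, q.1}).orderEmbOfFin (card_compl p.2 q.2 hpq) ⟨0, by omega⟩ <
      (Finset.Icc 1 n \ {p.1, q.1}).orderEmbOfFin (card_compl p.2 q.2 hpq) ⟨1, by omega⟩ :=
    (Finset.orderEmbOfFin _ _).strictMono (by simp)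
  rw [h0] at hlt'
  have hs : secondLetter p ∈ Set.range
      ((Finset.Icc 1 n \ {p.1, q.1}).orderEmbOfFin (card_compl p.2 q.2 hpq)) := by
    rw [Finset.range_orderEmbOfFin]
    simp only [Finset.coe_sdiff, Set.mem_sdiff, Finset.mem_coe, Finset.mem_Icc, Set.mem_insert_iff,
      Finset.coe_insert, Finset.coe_singleton, Set.mem_singleton_iff, secondLetter]
    split_ifs <;> omega
  obtain ⟨k, hk⟩ := hs
  have hk0 : k ≠ ⟨0, by omega⟩ := by
    intro e
    rw [e, h0] at hk
    simp only [secondLetter] at hk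
    split_ifs at hk <;> omega
  have hk1 : (⟨1, by omega⟩ : Fin (n - 2)) ≤ k := by
    rw [ne_eq, Fin.ext_iff] at hk0
    rw [Fin.le_def]
    simp only at hk0 ⊢
    omega
  have hle := (Finset.orderEmbOfFin (Finset.Icc 1 n \ {p.1, q.1})
    (card_compl p.2 q.2 hpq)).monotone hk1
  rw [hk] at hle
  simp only [Finset.mem_sdiff, Finset.mem_insert, Finset.mem_singleton] at hmem
  have h2 := hmem.2
  generalize (Finset.orderEmbOfFin (Finset.Icc 1 n \ {p.1, q.1})
    (card_compl p.2 q.2 hpq)) ⟨1, by omega⟩ = x at *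
  simp only [secondLetter] at hle ⊢
  split_ifs at hle ⊢ <;> omega

/-- Under these hypotheses the increasing first column starts with 1 and `secondLetter p`, so the
two long rows are {1, p} and {`secondLetter p`, q}. The pair (2, 3) is excluded because there the
second entry would be 4. -/
theorem ptRho_eq {p q : ℕ} (h : ValidPair n p q) (hp : 2 ≤ p) (hlt : p < q)
    (hne : ¬ (p = 2 ∧ q = 3)) :
    ptRho n p q = (-1 : ℤ) ^ (p + q + 1) • (pairVector n p q - pairVector n 1 q -
      pairVector n p (secondLetter p) + pairVector n 1 (secondLetter p)) := by
  have hpt := pt_eq h hlt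
  rw [pt, dif_pos h] at hpt
  rw [ptRho, dif_pos h, polytabloidRho, hpt]
  simp only [map_smul]
  rw [← Finset.smul_sum]
  congr 1
  have h0 := columnTableau_cellLeft_zero h.1 ⟨p, h.2.1⟩ ⟨q, h.2.2.1⟩ h.2.2.2 hp (by simp; omega)
  have h1 := columnTableau_cellLeft_one h.1 ⟨p, h.2.1⟩ ⟨q, h.2.2.1⟩ h.2.2.2 hp hlt hne
  have := sum_rowStabilizer_act_pairVector h.1 (columnTableau h.1 ⟨p, h.2.1⟩ ⟨q, h.2.2.1⟩ h.2.2.2)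
    rfl (columnTableau_cellRight_zero ..) rfl (columnTableau_cellRight_one ..)
  rw [h0, h1] at this
  exact this

/-! ### Triangular value matrices and the cokernel of a form -/

section Trigonal

variable {X : Type*} [AddCommGroup X] (B : LinearMap.BilinForm ℤ X) {m : ℕ}

/-- The matrix of values of a bilinear form on two tuples. -/
def valueMatrix (x y : Fin m → X) : Matrix (Fin m) (Fin m) ℤ := Matrix.of fun i j => B (x i) (y j)

theorem form_sum_left (x y : Fin m → X) (c : Fin m → ℤ) (j : Fin m) :
    B (∑ i, c i • x i) (y j) = (Matrix.vecMul c (valueMatrix B x y)) j := by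
  simp [valueMatrix, Matrix.vecMul, dotProduct, LinearMap.sum_apply]

theorem form_sum_right (x y : Fin m → X) (c : Fin m → ℤ) (i : Fin m) :
    B (x i) (∑ j, c j • y j) = (Matrix.mulVec (valueMatrix B x y) c) i := by
  simp [valueMatrix, Matrix.mulVec, dotProduct, mul_comm]

variable {B}

theorem linearIndependent_left {x y : Fin m → X} (h : (valueMatrix B x y).det ≠ 0) :
    LinearIndependent ℤ x := by
  rw [Fintype.linearIndependent_iff]
  intro c hc
  refine congrFun (Matrix.eq_zero_of_vecMul_eq_zero h ?_)
  ext j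
  rw [← form_sum_left, hc]
  simp

theorem linearIndependent_right {x y : Fin m → X} (h : (valueMatrix B x y).det ≠ 0) :
    LinearIndependent ℤ y := by
  rw [Fintype.linearIndependent_iff]
  intro c hc
  refine congrFun (Matrix.eq_zero_of_mulVec_eq_zero h ?_)
  ext j
  rw [← form_sum_right, hc]
  simp

theorem valueMatrix_basis (bx by' : Module.Basis (Fin m) ℤ X) (e : Module.Basis (Fin m) ℤ X) :
    valueMatrix B bx by' = (e.toMatrix bx).transpose * valueMatrix B e e * e.toMatrix by' := by
  ext i j
  rw [Matrix.mul_assoc, Matrix.mul_apply]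
  have h1 : (bx i : X) = ∑ k, e.toMatrix bx k i • e k := (e.sum_toMatrix_smul_self bx i).symm
  have h2 : (by' j : X) = ∑ k, e.toMatrix by' k j • e k := (e.sum_toMatrix_smul_self by' j).symm
  change B (bx i) (by' j) = _
  rw [h1, map_sum, LinearMap.sum_apply]
  refine Finset.sum_congr rfl fun k _ => ?_
  rw [map_smul, LinearMap.smul_apply, h2, form_sum_right]
  rfl

theorem det_valueMatrix_eq_or (bx by' e : Module.Basis (Fin m) ℤ X) :
    (valueMatrix B bx by').det = (valueMatrix B e e).det ∨
      (valueMatrix B bx by').det = -(valueMatrix B e e).det := by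
  have hu : ∀ b : Module.Basis (Fin m) ℤ X, IsUnit (e.toMatrix b).det := fun b => by
    rw [← e.det_apply]
    exact e.isUnit_det b
  rw [valueMatrix_basis bx by' e, Matrix.det_mul, Matrix.det_mul, Matrix.det_transpose]
  rcases Int.isUnit_iff.1 (hu bx) with h | h <;> rcases Int.isUnit_iff.1 (hu by') with h' | h' <;>
    simp [h, h']

/-- Read a functional through its values on `by'`, multiplied by `T⁻¹`. The functional of ∑ aᵢ `bx
i` then has coordinates aᵢ dᵢ, so the image of the form is exactly the product of the ideals
generated by the dᵢ. -/
theorem nonempty_formCokernel_equiv (bx by' : Module.Basis (Fin m) ℤ X)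
    (T : Matrix (Fin m) (Fin m) ℤ) (hT : IsUnit T.det) (d : Fin m → ℤ)
    (h : ∀ i j, B (bx i) (by' j) = d i * T i j) :
    Nonempty (FormCokernel B ≃+ ((i : Fin m) → ZMod (d i).natAbs)) := by
  have hTT : T * T⁻¹ = 1 := Matrix.mul_nonsing_inv T hT
  have hTT' : T⁻¹ * T = 1 := Matrix.nonsing_inv_mul T hT
  have hval : ∀ a : Fin m → ℤ, Matrix.vecMul a (valueMatrix B bx by') =
      Matrix.vecMul (fun i => a i * d i) T := by
    intro a
    ext j
    simp [valueMatrix, Matrix.vecMul, dotProduct, h, mul_assoc]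
  let ψ : Module.Dual ℤ X →+ ((i : Fin m) → ZMod (d i).natAbs) :=
    { toFun := fun f i => ((Matrix.vecMul (fun j => f (by' j)) T⁻¹ i : ℤ) : ZMod (d i).natAbs)
      map_zero' := by
        ext i
        have : (fun j => (0 : Module.Dual ℤ X) (by' j)) = 0 := rfl
        rw [this, Matrix.zero_vecMul]
        simp
      map_add' := fun f g => by
        ext i
        have : (fun j => (f + g) (by' j)) = (fun j => f (by' j)) + (fun j => g (by' j)) := rfl
        rw [this, Matrix.add_vecMul]
        simp }
  have hψ : Function.Surjective ψ.toIntLinearMap := by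
    intro z
    choose c hc using fun i => ZMod.intCast_surjective (z i)
    refine ⟨by'.constr ℤ (Matrix.vecMul c T), ?_⟩
    ext i
    change ((Matrix.vecMul (fun j => _) T⁻¹ i : ℤ) : ZMod (d i).natAbs) = _
    simp only [Module.Basis.constr_basis]
    rw [Matrix.vecMul_vecMul, hTT, Matrix.vecMul_one, hc]
  have hker : LinearMap.range B = LinearMap.ker ψ.toIntLinearMap := by
    ext f
    rw [LinearMap.mem_range, LinearMap.mem_ker]
    have h0 : ψ.toIntLinearMap f = 0 ↔
        ∀ i, d i ∣ Matrix.vecMul (fun j => f (by' j)) T⁻¹ i := by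
      rw [funext_iff]
      refine forall_congr' fun i => ?_
      change ((Matrix.vecMul (fun j => f (by' j)) T⁻¹ i : ℤ) : ZMod (d i).natAbs) = 0 ↔ _
      rw [ZMod.intCast_zmod_eq_zero_iff_dvd, Int.natAbs_dvd]
    rw [h0]
    constructor
    · rintro ⟨v, rfl⟩ i
      have hv : (fun j => B v (by' j)) = Matrix.vecMul (fun i => bx.repr v i * d i) T := by
        rw [← hval]
        ext j
        rw [← form_sum_left, bx.sum_repr]
      rw [hv, Matrix.vecMul_vecMul, hTT, Matrix.vecMul_one]
      exact dvd_mul_left _ _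
    · intro hd
      choose a ha using hd
      refine ⟨∑ i, a i • bx i, by'.ext fun j => ?_⟩
      rw [form_sum_left, hval]
      have : (fun i => a i * d i) = Matrix.vecMul (fun j => f (by' j)) T⁻¹ := by
        ext i
        rw [ha, mul_comm]
      rw [this, Matrix.vecMul_vecMul, hTT', Matrix.vecMul_one]
  exact ⟨((Submodule.quotEquivOfEq _ _ hker).trans
    (LinearMap.quotKerEquivOfSurjective _ hψ)).toAddEquiv⟩

/-- Triangularity makes the determinant of the value matrix the nonzero product of its diagonal,
which forces independence of both tuples. Dividing each row by its diagonal entry leaves a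
unitriangular integer matrix. -/
theorem areTrigonalizingBases_of_span {x y : Fin m → X}
    (hx : Submodule.span ℤ (Set.range x) = ⊤) (hy : Submodule.span ℤ (Set.range y) = ⊤)
    (h0 : ∀ i, B (x i) (y i) ≠ 0) (hl : ∀ i j, j < i → B (x i) (y j) = 0)
    (hu : ∀ i j, i < j → B (x i) (y i) ∣ B (x i) (y j))
    (hd : ∀ i j : Fin m, (j : ℕ) = (i : ℕ) + 1 → B (x i) (y i) ∣ B (x j) (y j)) :
    AreTrigonalizingBases B x y := by
  have hdet : (valueMatrix B x y).det = ∏ i, B (x i) (y i) :=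
    Matrix.det_of_isUpperTriangular fun i j hij => hl i j hij
  have hne : (valueMatrix B x y).det ≠ 0 := by
    rw [hdet]
    exact Finset.prod_ne_zero_iff.2 fun i _ => h0 i
  have ix := linearIndependent_left hne
  have iy := linearIndependent_right hne
  let bx := Module.Basis.mk ix hx.ge
  let by' := Module.Basis.mk iy hy.ge
  have ex : ⇑bx = x := Module.Basis.coe_mk ..
  have ey : ⇑by' = y := Module.Basis.coe_mk ..
  refine ⟨ix, hx, iy, hy, h0, hl, hu, hd, fun e => ?_, ?_⟩
  · rw [← hdet, ← ex, ← ey]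
    exact det_valueMatrix_eq_or bx by' e
  · refine nonempty_formCokernel_equiv bx by'
      (Matrix.of fun i j => B (x i) (y j) / B (x i) (y i)) ?_ _ fun i j => ?_
    · rw [Matrix.det_of_isUpperTriangular]
      · simp [Int.ediv_self (h0 _)]
      · intro i j hij
        simp [hl i j hij]
    · rw [ex, ey, Matrix.of_apply]
      rcases lt_trichotomy i j with hij | rfl | hij
      · exact (Int.mul_ediv_cancel' (hu i j hij)).symm
      · exact (Int.mul_ediv_cancel' dvd_rfl).symm
      · simp [hl i j hij]

end Trigonal

/-! ### Grouping the cyclic factors -/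

section Cokernel

/-- Splitting a product of cyclic groups along an equivalence of index types. -/
theorem nonempty_pi_zmod_equiv {ι κ : Type*} (e : κ ≃ ι) (f : ι → ℕ) (g : κ → ℕ)
    (h : ∀ k, f (e k) = g k) : Nonempty (((i : ι) → ZMod (f i)) ≃+ ((k : κ) → ZMod (g k))) := by
  have h1 : g = fun k => f (e k) := funext fun k => (h k).symm
  subst h1
  exact ⟨(LinearEquiv.piCongrLeft ℤ (fun i => ZMod (f i)) e).symm.toAddEquiv⟩

theorem nonempty_sum_zmod_equiv {ι κ : Type*} (g : ι ⊕ κ → ℕ) :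
    Nonempty (((i : ι ⊕ κ) → ZMod (g i)) ≃+
      ((i : ι) → ZMod (g (Sum.inl i))) × ((k : κ) → ZMod (g (Sum.inr k)))) :=
  ⟨(LinearEquiv.sumPiEquivProdPi ℤ ι κ (fun i => ZMod (g i))).toAddEquiv⟩

theorem nonempty_pi_fin_succ_add_equiv {m a k : ℕ} (hm : m = 1 + (a + (1 + k))) (D : Fin m → ℕ)
    (d₁ d₂ d₃ d₄ : ℕ) (h1 : ∀ i : Fin m, i.1 = 0 → D i = d₁)
    (h2 : ∀ i : Fin m, 1 ≤ i.1 → i.1 < 1 + a → D i = d₂) (h3 : ∀ i : Fin m, i.1 = 1 + a → D i = d₃)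
    (h4 : ∀ i : Fin m, 1 + a < i.1 → D i = d₄) :
    Nonempty (((i : Fin m) → ZMod (D i)) ≃+
      ZMod d₁ × (Fin a → ZMod d₂) × ZMod d₃ × (Fin k → ZMod d₄)) := by
  subst hm
  obtain ⟨e1⟩ := nonempty_pi_zmod_equiv
    ((Equiv.sumCongr (Equiv.refl _) ((Equiv.sumCongr (Equiv.refl _) finSumFinEquiv).trans
      finSumFinEquiv)).trans finSumFinEquiv) D
    (Sum.elim (fun _ : Fin 1 => d₁) (Sum.elim (fun _ : Fin a => d₂)
      (Sum.elim (fun _ : Fin 1 => d₃) (fun _ : Fin k => d₄)))) (by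
    rintro (i | i | i | i)
    · exact h1 _ (by simp)
    · exact h2 _ (by simp) (by simp)
    · exact h3 _ (by simp)
    · exact h4 _ (by simp))
  obtain ⟨e2⟩ := nonempty_sum_zmod_equiv (Sum.elim (fun _ : Fin 1 => d₁)
    (Sum.elim (fun _ : Fin a => d₂) (Sum.elim (fun _ : Fin 1 => d₃) (fun _ : Fin k => d₄))))
  obtain ⟨e3⟩ := nonempty_sum_zmod_equiv (Sum.elim (fun _ : Fin a => d₂)
    (Sum.elim (fun _ : Fin 1 => d₃) (fun _ : Fin k => d₄)))
  obtain ⟨e4⟩ := nonempty_sum_zmod_equiv (Sum.elim (fun _ : Fin 1 => d₃) (fun _ : Fin k => d₄))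
  have u : ∀ d : ℕ, (Fin 1 → ZMod d) ≃+ ZMod d := fun d =>
    (LinearEquiv.funUnique (Fin 1) ℤ (ZMod d)).toAddEquiv
  exact ⟨e1.trans (e2.trans (AddEquiv.prodCongr (u _) (e3.trans (AddEquiv.prodCongr
    (AddEquiv.refl _) (e4.trans (AddEquiv.prodCongr (u _) (AddEquiv.refl _)))))))⟩

end Cokernel

/-! ### Functions on edges subject to the relations -/

section Vanishing

variable {Q : Type*} [AddCommGroup Q]

/-- A function on pairs satisfying the relations between the normalized polytabloids. -/
structure IsPairFunction (n : ℕ) (g : ℕ → ℕ → Q) : Prop where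
  comm : ∀ p q, g p q = g q p
  self : ∀ p, g p p = 0
  star : ∀ p ∈ Finset.Icc 1 n, ∑ q ∈ Finset.Icc 1 n, g p q = 0
  total : ∑ p ∈ Finset.Icc 1 n, ∑ q ∈ Finset.Ico 1 p, g p q = 0

theorem isPairFunction_pairVector {n : ℕ} (hn : 4 ≤ n) : IsPairFunction n (pairVector n) :=
  ⟨pairVector_comm n, pairVector_self n, fun _ hp => sum_pairVector hn hp, sum_sum_pairVector hn⟩

theorem IsPairFunction.map {Q' : Type*} [AddCommGroup Q'] {n : ℕ} {g : ℕ → ℕ → Q}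
    (h : IsPairFunction n g) (f : Q →+ Q') : IsPairFunction n fun p q => f (g p q) where
  comm p q := by rw [h.comm]
  self p := by rw [h.self, map_zero]
  star p hp := by rw [← map_sum, h.star p hp, map_zero]
  total := by simp only [← map_sum, h.total, map_zero]

variable {g : ℕ → ℕ → Q} (hg : IsPairFunction n g)

include hg

/-- The vertex relation at k ≥ 4 kills the edge {1, k}. On the triangle 1, 2, 3 the relations at 2
and 3 together with the total relation kill the remaining edges; vertex relations alone would leave
2-torsion. -/
theorem IsPairFunction.eq_zero_of_ge_two (hn : 3 ≤ n)
    (h : ∀ b c, 2 ≤ b → b < c → c ≤ n → ¬ (b = 2 ∧ c = 3) → g b c = 0) :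
    ∀ p ∈ Finset.Icc 1 n, ∀ q ∈ Finset.Icc 1 n, p < q → g p q = 0 := by
  have h4 : ∀ k, 4 ≤ k → k ≤ n → g k 1 = 0 := by
    intro k hk hk'
    rw [← hg.star k (Finset.mem_Icc.2 ⟨by omega, hk'⟩)]
    refine (Finset.sum_eq_single 1 ?_ ?_).symm
    · intro q hq hq1
      rw [Finset.mem_Icc] at hq
      rcases lt_trichotomy q k with hlt | rfl | hlt
      · rw [hg.comm]
        exact h q k (by omega) hlt hk' (by omega)
      · exact hg.self q
      · exact h k q (by omega) hlt hq.2 (by omega)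
    · intro h1
      exact absurd (Finset.mem_Icc.2 ⟨le_rfl, by omega⟩) h1
  have e2 : g 2 1 + g 2 3 = 0 := by
    rw [← hg.star 2 (Finset.mem_Icc.2 ⟨by omega, by omega⟩), ← Finset.sum_pair (by norm_num)]
    refine Finset.sum_subset ?_ ?_
    · intro x hx
      simp only [Finset.mem_insert, Finset.mem_singleton] at hx
      simp; omega
    · intro q hq hq1
      simp only [Finset.mem_insert, Finset.mem_singleton, Finset.mem_Icc] at hq hq1
      rcases eq_or_ne q 2 with rfl | h2
      · exact hg.self 2
      · exact h 2 q (by omega) (by omega) hq.2 (by omega)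
  have e3 : g 3 1 + g 3 2 = 0 := by
    rw [← hg.star 3 (Finset.mem_Icc.2 ⟨by omega, by omega⟩), ← Finset.sum_pair (by norm_num)]
    refine Finset.sum_subset ?_ ?_
    · intro x hx
      simp only [Finset.mem_insert, Finset.mem_singleton] at hx
      simp; omega
    · intro q hq hq1
      simp only [Finset.mem_insert, Finset.mem_singleton, Finset.mem_Icc] at hq hq1
      rcases eq_or_ne q 3 with rfl | h2
      · exact hg.self 3
      · exact h 3 q (by omega) (by omega) hq.2 (by omega)
  have et : g 2 1 + (g 3 1 + g 3 2) = 0 := by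
    have i2 : Finset.Ico 1 2 = {1} := rfl
    have i3 : Finset.Ico 1 3 = {1, 2} := rfl
    have t2 : ∑ q ∈ Finset.Ico 1 2, g 2 q = g 2 1 := by rw [i2, Finset.sum_singleton]
    have t3 : ∑ q ∈ Finset.Ico 1 3, g 3 q = g 3 1 + g 3 2 := by
      rw [i3, Finset.sum_pair (by norm_num)]
    rw [← t3, ← t2, ← hg.total,
      ← Finset.sum_pair (f := fun p => ∑ q ∈ Finset.Ico 1 p, g p q) (by norm_num)]
    refine Finset.sum_subset ?_ ?_
    · intro x hx
      simp only [Finset.mem_insert, Finset.mem_singleton] at hx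
      simp; omega
    · intro p hp hp1
      simp only [Finset.mem_insert, Finset.mem_singleton, Finset.mem_Icc] at hp hp1
      refine Finset.sum_eq_zero fun q hq => ?_
      rw [Finset.mem_Ico] at hq
      rcases eq_or_ne q 1 with rfl | h2
      · exact h4 p (by omega) hp.2
      · rw [hg.comm]
        exact h q p (by omega) hq.2 hp.2 (by omega)
  rw [e3, add_zero] at et
  rw [et, zero_add] at e2
  rw [hg.comm 3 2, e2, add_zero] at e3
  intro p hp q hq hpq
  rw [Finset.mem_Icc] at hp hq
  by_cases p1 : p = 1
  · subst p1
    rw [hg.comm]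
    by_cases q2 : q = 2
    · rw [q2, et]
    by_cases q3 : q = 3
    · rw [q3, e3]
    exact h4 q (by omega) hq.2
  · by_cases h23 : p = 2 ∧ q = 3
    · rw [h23.1, h23.2, e2]
    · exact h p q (by omega) hpq hq.2 h23

omit hg in
theorem sum_Icc_split {f : ℕ → Q} (hn : 3 ≤ n) :
    ∑ q ∈ Finset.Icc 1 n, f q =
      ∑ q ∈ Finset.Icc 1 (n - 3), f q + f (n - 2) + f (n - 1) + f n := by
  obtain ⟨m, rfl⟩ := Nat.exists_eq_add_of_le' hn
  have h1 : m + 3 - 3 = m := rfl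
  have h2 : m + 3 - 2 = m + 1 := rfl
  have h3 : m + 3 - 1 = m + 1 + 1 := rfl
  rw [h1, h2, h3, ← Finset.sum_Icc_succ_top (by omega), ← Finset.sum_Icc_succ_top (by omega),
    ← Finset.sum_Icc_succ_top (by omega)]

/-- The alternating sum of a pair function over the 4-cycle attached to `(b, c)`. -/
def cycleSum (g : ℕ → ℕ → Q) (b c : ℕ) : Q :=
  g b c - g 1 c - g b (secondLetter b) + g 1 (secondLetter b)

/-- The common values of a pair function with vanishing 4-cycle sums. -/
theorem IsPairFunction.exists_const (hn : 6 ≤ n)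
    (hc : ∀ b c, 2 ≤ b → b < c → c ≤ n - 1 → ¬ (b = 2 ∧ c = 3) → ¬ (b = n - 2 ∧ c = n - 1) →
      cycleSum g b c = 0)
    (hk : ∀ k, 2 ≤ k → k ≤ n - 2 → g k (n - 1) = g 1 (n - 1)) :
    ∃ s r t, (∀ b c, 1 ≤ b → b < c → c ≤ n - 3 → g b c = s) ∧
      (∀ b, 1 ≤ b → b < n - 2 → g b (n - 2) = r) ∧
      (∀ b, 1 ≤ b → b < n - 1 → g b (n - 1) = t) := by
  have sec2 : secondLetter 2 = 3 := rfl
  have sec3 : ∀ b, 3 ≤ b → secondLetter b = 2 := fun b hb => if_neg (by omega)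
  -- In the 4-cycle of `(b, n - 1)` the edges at n-1 cancel by `hk`, leaving a comparison of edges
  -- at 2. Inserted into the 4-cycles of the other pairs, this compares edges with a common upper
  -- endpoint.
  have hA : ∀ b, 3 ≤ b → b ≤ n - 3 → g b 2 = g 1 2 := by
    intro b hb hb'
    have := hc b (n - 1) (by omega) (by omega) le_rfl (by omega) (by omega)
    rw [cycleSum, sec3 b hb, hk b (by omega) (by omega), sub_self, zero_sub] at this
    exact (neg_add_eq_zero.1 this)
  have hB : g 2 3 = g 1 3 := by
    have := hc 2 (n - 1) (by omega) (by omega) le_rfl (by omega) (by omega)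
    rw [cycleSum, sec2, hk 2 (by omega) (by omega), sub_self, zero_sub] at this
    exact (neg_add_eq_zero.1 this)
  have hC : ∀ c, 4 ≤ c → c ≤ n - 2 → g 2 c = g 1 c := by
    intro c h4 hc'
    have := hc 2 c (by omega) (by omega) (by omega) (by omega) (by omega)
    rw [cycleSum, sec2, hB, sub_add_cancel] at this
    exact sub_eq_zero.1 this
  have hD : ∀ b c, 3 ≤ b → b < c → c ≤ n - 2 → g b c = g 1 c := by
    intro b c hb hbc hc'
    have := hc b c (by omega) (by omega) (by omega) (by omega) (by omega)
    rw [cycleSum, sec3 b hb, hA b hb (by omega), sub_add_cancel] at this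
    exact sub_eq_zero.1 this
  have hE : ∀ b c, 1 ≤ b → b < c → 3 ≤ c → c ≤ n - 2 → g b c = g 1 c := by
    intro b c hb hbc hc3 hc'
    by_cases b1 : b = 1
    · rw [b1]
    by_cases b2 : b = 2
    · subst b2
      by_cases c3 : c = 3
      · rw [c3, hB]
      · exact hC c (by omega) hc'
    · exact hD b c (by omega) hbc hc'
  refine ⟨g 1 2, g 1 (n - 2), g 1 (n - 1), ?_, ?_, ?_⟩
  · intro b c hb hbc hc'
    by_cases c2 : c = 2
    · rw [c2, show b = 1 by omega]
    · rw [hE b c hb hbc (by omega) (by omega), ← hE 2 c (by omega) (by omega) (by omega) (by omega),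
        hg.comm, hA c (by omega) (by omega)]
  · intro b hb hb'
    exact hE b _ hb hb' (by omega) le_rfl
  · intro b hb hb'
    by_cases b1 : b = 1
    · rw [b1]
    · exact hk b (by omega) (by omega)

/-- These are the vertex relations at n-1 and at 3 and the total relation, evaluated on the
constants. The edges {n-1, n} and {3, n} stay as unknowns because they occur in z. -/
theorem IsPairFunction.const_relations (hn : 6 ≤ n) {s r t : Q}
    (hs : ∀ b c, 1 ≤ b → b < c → c ≤ n - 3 → g b c = s)
    (hr : ∀ b, 1 ≤ b → b < n - 2 → g b (n - 2) = r)
    (ht : ∀ b, 1 ≤ b → b < n - 1 → g b (n - 1) = t) :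
    (n - 2 : ℤ) • t + g (n - 1) n = 0 ∧ (n - 4 : ℤ) • s + r + t + g 3 n = 0 ∧
      (∑ i ∈ Finset.range (n - 3), i : ℤ) • s + (n - 3 : ℤ) • r + (n - 2 : ℤ) • t = 0 := by
  have htop : ∀ p, ∀ v : Q, (∀ b, 1 ≤ b → b < p → g b p = v) →
      ∑ q ∈ Finset.Ico 1 p, g p q = ((p - 1 : ℕ) : ℤ) • v := by
    intro p v hv
    rw [Finset.sum_congr rfl fun q hq => by
      rw [hg.comm, hv q (Finset.mem_Ico.1 hq).1 (Finset.mem_Ico.1 hq).2]]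
    rw [Finset.sum_const, Nat.card_Ico, natCast_zsmul]
  have c2 : ((n - 1 - 1 : ℕ) : ℤ) = n - 2 := by omega
  have c3 : ((n - 2 - 1 : ℕ) : ℤ) = n - 3 := by omega
  refine ⟨?_, ?_, ?_⟩
  · rw [← c2, ← htop (n - 1) t ht, ← hg.star (n - 1) (Finset.mem_Icc.2 ⟨by omega, by omega⟩)]
    have e : Finset.Icc 1 n = Finset.Ico 1 (n - 1) ∪ {n - 1, n} := by
      ext k
      simp only [Finset.mem_Icc, Finset.mem_union, Finset.mem_Ico, Finset.mem_insert,
        Finset.mem_singleton]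
      omega
    rw [e, Finset.sum_union, Finset.sum_pair (by omega), hg.self, zero_add]
    rw [Finset.disjoint_left]
    intro k
    simp only [Finset.mem_Ico, Finset.mem_insert, Finset.mem_singleton]
    omega
  · have h := hg.star 3 (Finset.mem_Icc.2 ⟨by omega, by omega⟩)
    rw [sum_Icc_split (by omega), hr 3 (by omega) (by omega), ht 3 (by omega) (by omega),
      ← Finset.sum_erase (a := 3) _ (hg.self 3)] at h
    have h2 : ∑ q ∈ (Finset.Icc 1 (n - 3)).erase 3, g 3 q = (n - 4 : ℤ) • s := by
      rw [Finset.sum_congr rfl fun q hq => ?_, Finset.sum_const]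
      · rw [Finset.card_erase_of_mem (Finset.mem_Icc.2 ⟨by omega, by omega⟩), Nat.card_Icc,
          ← natCast_zsmul]
        congr 1
        omega
      · rw [Finset.mem_erase, Finset.mem_Icc] at hq
        rcases lt_or_gt_of_ne hq.1 with h | h
        · rw [hg.comm]
          exact hs _ _ (by omega) h (by omega)
        · exact hs _ _ (by omega) h (by omega)
    rw [← h2]
    exact h
  · have h := hg.total
    rw [sum_Icc_split (by omega), htop (n - 2) r hr, htop (n - 1) t ht, c2, c3] at h
    -- By the vertex relation at n, the edges at n drop out of the total relation.
    have hlast : ∑ q ∈ Finset.Ico 1 n, g n q = 0 := by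
      rw [← hg.star n (Finset.mem_Icc.2 ⟨by omega, le_rfl⟩)]
      obtain ⟨m, rfl⟩ : ∃ m, n = m + 1 := ⟨n - 1, by omega⟩
      rw [Finset.sum_Icc_succ_top (by omega), hg.self, add_zero]
      rfl
    rw [hlast, add_zero] at h
    rw [← h]
    congr 2
    rw [Finset.sum_congr rfl fun p hp => htop p s fun b hb hb' =>
      hs b p hb hb' (Finset.mem_Icc.1 hp).2, ← Finset.sum_smul]
    congr 1
    have e := Finset.sum_Ico_add' (fun i : ℕ => ((i - 1 : ℕ) : ℤ)) 0 (n - 3) 1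
    rw [Finset.range_eq_Ico]
    exact e

theorem IsPairFunction.eq_zero_of_const_zero (hn : 6 ≤ n)
    (hs : ∀ b c, 1 ≤ b → b < c → c ≤ n - 3 → g b c = 0)
    (hr : ∀ b, 1 ≤ b → b < n - 2 → g b (n - 2) = 0)
    (ht : ∀ b, 1 ≤ b → b < n - 1 → g b (n - 1) = 0) :
    ∀ p ∈ Finset.Icc 1 n, ∀ q ∈ Finset.Icc 1 n, p < q → g p q = 0 := by
  have h1 : ∀ p q, 1 ≤ p → p < q → q < n → g p q = 0 := by
    intro p q hp hpq hq
    by_cases e1 : q = n - 1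
    · subst e1; exact ht p hp hpq
    by_cases e2 : q = n - 2
    · subst e2; exact hr p hp hpq
    exact hs p q hp hpq (by omega)
  intro p hp q hq hpq
  rw [Finset.mem_Icc] at hp hq
  by_cases hqn : q = n
  · subst hqn
    rw [← hg.star p (Finset.mem_Icc.2 hp)]
    refine (Finset.sum_eq_single q ?_ ?_).symm
    · intro k hk hkq
      rw [Finset.mem_Icc] at hk
      rcases lt_trichotomy p k with h | rfl | h
      · exact h1 p k hp.1 h (by omega)
      · exact hg.self p
      · rw [hg.comm]
        exact h1 k p hk.1 h hpq
    · intro h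
      exact absurd (Finset.mem_Icc.2 hq) h
  · exact h1 p q hp.1 hpq (by omega)

omit hg in
theorem sum_range_cast (a b : ℕ) (h : b * 2 = a * (a - 1)) :
    (∑ i ∈ Finset.range a, i : ℤ) = b := by
  have := Finset.sum_range_id_mul_two a
  rw [← h] at this
  have h2 : ∑ i ∈ Finset.range a, i = b := by omega
  rw [← h2]
  push_cast
  rfl

omit hg in
-- For n = 2j+7. Eliminating `u` and `w` leaves two equations in `r` and `t` whose determinant is
-- (2j+5)² - (2j+6)(2j+4) = 1. This is what the coefficients of x_{n-1} achieve.
theorem eq_zero_of_odd_relations (j : ℤ) {G : ℤ} {s r t u w v : Q} (hs : s = 0)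
    (h1 : (2 * j + 7 - 2) • t + u = 0) (h2 : (2 * j + 7 - 4) • s + r + t + w = 0)
    (h3 : G • s + (2 * j + 7 - 3) • r + (2 * j + 7 - 2) • t = 0) (hv : v = s - r)
    (h4 : (j + 2) • v + (j + 3) • (w + u + (2 * j + 7 - 3) • t) = 0) :
    r = 0 ∧ t = 0 := by
  subst hs hv
  have hu : u = -((2 * j + 7 - 2) • t) := by rw [← add_eq_zero_iff_eq_neg, add_comm, h1]
  have hw : w = -(r + t) := by
    rw [← add_eq_zero_iff_eq_neg, ← h2]; module
  subst hu hw
  have h5 : (2 * j + 5) • r + (2 * j + 6) • t = 0 := by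
    linear_combination (norm := module) (-1 : ℤ) • h4
  have h6 : (2 * j + 4) • r + (2 * j + 5) • t = 0 := by
    linear_combination (norm := module) h3
  constructor
  · linear_combination (norm := module) (2 * j + 5) • h5 - (2 * j + 6) • h6
  · linear_combination (norm := module) (2 * j + 5) • h6 - (2 * j + 4) • h5

omit hg in
-- For n = 2j+8. The combination `h4` - `h1` + `h2` reads (n-3)s + 2w = 0, while twice `hs` reads
-- (n-2)s + 2w = 0; so s = 0, and r and t follow.
theorem eq_zero_of_even_relations (j : ℤ) {s r t u w v : Q}
    (hs : w + (j + 3) • s = 0)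
    (h1 : (2 * j + 8 - 2) • t + u = 0) (h2 : (2 * j + 8 - 4) • s + r + t + w = 0)
    (h3 : ((2 * j + 5) * (j + 2)) • s + (2 * j + 8 - 3) • r + (2 * j + 8 - 2) • t = 0)
    (hv : v = s - r) (h4 : v + (w + u + (2 * j + 8 - 3) • t) = 0) :
    s = 0 ∧ r = 0 ∧ t = 0 := by
  subst hv
  have h5 : s = 0 := by
    linear_combination (norm := module) (2 : ℤ) • hs - h4 + h1 - h2
  subst h5
  have h6 : r + t = 0 := by linear_combination (norm := module) h2 - hs
  have h7 : t = 0 := by linear_combination (norm := module) h3 - (2 * j + 5) • h6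
  subst h7
  exact ⟨rfl, by simpa using h6, rfl⟩

omit hg in
-- For n = 6 the edge {3, 4} ends at n-2 and so takes the value `r` instead of `s`. After
-- elimination of `u` and `w` the 3×3 system is again unimodular; the multipliers come from its
-- inverse.
theorem eq_zero_of_six_relations {s r t u w v : Q} (hs : w + (2 : ℤ) • r = 0)
    (h1 : (4 : ℤ) • t + u = 0) (h2 : (2 : ℤ) • s + r + t + w = 0)
    (h3 : (3 : ℤ) • s + (3 : ℤ) • r + (4 : ℤ) • t = 0)
    (hv : v = s - r) (h4 : v + (w + u + (3 : ℤ) • t) = 0) :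
    s = 0 ∧ r = 0 ∧ t = 0 := by
  subst hv
  have hw : w = -((2 : ℤ) • r) := by rw [← add_eq_zero_iff_eq_neg, hs]
  have hu : u = -((4 : ℤ) • t) := by rw [← add_eq_zero_iff_eq_neg, add_comm, h1]
  subst hw hu
  refine ⟨?_, ?_, ?_⟩
  · linear_combination (norm := module) (-9 : ℤ) • h2 + (7 : ℤ) • h4 + (4 : ℤ) • h3
  · linear_combination (norm := module) (-7 : ℤ) • h2 + (5 : ℤ) • h4 + (3 : ℤ) • h3
  · linear_combination (norm := module) (12 : ℤ) • h2 + (-9 : ℤ) • h4 + (-5 : ℤ) • h3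

end Vanishing

/-! ### Enumerating the edges that index the tuples -/

section PairList

/-- The pairs enumerated by a pair list. -/
def pairFinset (n : ℕ) : Finset (ℕ × ℕ) :=
  (Finset.Icc 2 (n - 2) ×ˢ Finset.Icc 2 (n - 2)).filter fun p => p.1 < p.2 ∧ p ≠ (2, 3)

theorem mem_pairFinset {p : ℕ × ℕ} :
    p ∈ pairFinset n ↔ 2 ≤ p.1 ∧ p.1 < p.2 ∧ p.2 ≤ n - 2 ∧ p ≠ (2, 3) := by
  simp only [pairFinset, Finset.mem_filter, Finset.mem_product, Finset.mem_Icc]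
  constructor
  · rintro ⟨⟨⟨h1, h2⟩, h3, h4⟩, h5, h6⟩
    exact ⟨h1, h5, h4, h6⟩
  · rintro ⟨h1, h2, h3, h4⟩
    exact ⟨⟨⟨h1, by omega⟩, by omega, h3⟩, h2, h4⟩

theorem card_pairFinset (hn : 5 ≤ n) : (pairFinset n).card = (n - 3).choose 2 - 1 := by
  have h1 : insert (2, 3) (pairFinset n) =
      (Finset.range (n - 3)).biUnion fun i => (Finset.range i).image fun j => (j + 2, i + 2) := by
    ext ⟨p, q⟩
    simp only [Finset.mem_insert, mem_pairFinset, Finset.mem_biUnion, Finset.mem_image,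
      Finset.mem_range, Prod.mk.injEq, ne_eq]
    constructor
    · intro h
      exact ⟨q - 2, by omega, p - 2, by omega, by omega, by omega⟩
    · rintro ⟨i, hi, j, hj, rfl, rfl⟩
      omega
  have h2 := congrArg Finset.card h1
  rw [Finset.card_insert_of_notMem (by simp [mem_pairFinset]), Finset.card_biUnion] at h2
  · have h3 : ∀ i ∈ Finset.range (n - 3),
        ((Finset.range i).image fun j => (j + 2, i + 2)).card = i := by
      intro i _
      rw [Finset.card_image_of_injective, Finset.card_range]
      intro j j' h
      simpa using h
    rw [Finset.sum_congr rfl h3, Finset.sum_range_id, ← Nat.choose_two_right] at h2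
    omega
  · intro i _ j _ hij
    rw [Function.onFun, Finset.disjoint_left]
    rintro ⟨p, q⟩ h h'
    simp only [Finset.mem_image, Prod.mk.injEq] at h h'
    omega

/-- Sort the pairs lexicographically with the larger entry first, and run through the increasing
enumeration backwards. -/
theorem exists_isPairList (hn : 5 ≤ n) : ∃ b c : ℕ → ℕ, IsPairList n b c := by
  let F : Finset (ℕ ×ₗ ℕ) := (pairFinset n).image fun p => toLex (p.2, p.1)
  have hF : F.card = (n - 3).choose 2 - 1 := by
    rw [Finset.card_image_of_injective, card_pairFinset hn]
    rintro ⟨p, q⟩ ⟨p', q'⟩ h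
    simp only [EmbeddingLike.apply_eq_iff_eq, Prod.mk.injEq] at h ⊢
    exact h.symm
  have hpos : ∀ i, i ∈ Finset.Icc 1 ((n - 3).choose 2 - 1) →
      (n - 3).choose 2 - 1 - i < (n - 3).choose 2 - 1 := by
    intro i hi
    rw [Finset.mem_Icc] at hi
    omega
  let e : ℕ → ℕ × ℕ := fun i => if hi : i ∈ Finset.Icc 1 ((n - 3).choose 2 - 1) then
    ofLex (F.orderEmbOfFin hF ⟨_, hpos i hi⟩) else 0
  have he : ∀ i (hi : i ∈ Finset.Icc 1 ((n - 3).choose 2 - 1)),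
      e i = ofLex (F.orderEmbOfFin hF ⟨_, hpos i hi⟩) := fun i hi => dif_pos hi
  refine ⟨fun i => (e i).2, fun i => (e i).1, fun i hi => ?_, fun i hi j hj hij => ?_⟩
  · have hm := Finset.orderEmbOfFin_mem F hF ⟨_, hpos i hi⟩
    obtain ⟨⟨p, q⟩, hp, hq⟩ := Finset.mem_image.1 hm
    rw [mem_pairFinset] at hp
    simp only [he i hi, ← hq, ofLex_toLex, Finset.mem_Icc]
    exact ⟨⟨hp.1, by omega⟩, ⟨by omega, hp.2.2.1⟩, hp.2.1, hp.2.2.2⟩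
  · have hlt : F.orderEmbOfFin hF ⟨_, hpos j hj⟩ < F.orderEmbOfFin hF ⟨_, hpos i hi⟩ := by
      apply (F.orderEmbOfFin hF).strictMono
      rw [Fin.mk_lt_mk]
      rw [Finset.mem_Icc] at hi hj
      omega
    rw [Prod.Lex.lt_iff] at hlt
    simp only [he i hi, he j hj]
    rcases hlt with h | ⟨h, h'⟩
    · exact Or.inl h
    · exact Or.inr ⟨h.symm, h'⟩

/-- The strict ordering makes the list injective, and it has as many members as there are admissible
pairs, so it exhausts them. -/
theorem IsPairList.exists_eq (hn : 5 ≤ n) {b c : ℕ → ℕ} (h : IsPairList n b c) {p q : ℕ}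
    (hp : 2 ≤ p) (hpq : p < q) (hq : q ≤ n - 2) (hne : ¬ (p = 2 ∧ q = 3)) :
    ∃ i ∈ Finset.Icc 1 ((n - 3).choose 2 - 1), b i = p ∧ c i = q := by
  have himg : (Finset.Icc 1 ((n - 3).choose 2 - 1)).image (fun i => (b i, c i)) =
      pairFinset n := by
    apply Finset.eq_of_subset_of_card_le
    · intro x hx
      obtain ⟨i, hi, rfl⟩ := Finset.mem_image.1 hx
      obtain ⟨h1, h2, h3, h4⟩ := h.mem i hi
      rw [Finset.mem_Icc] at h1 h2
      exact mem_pairFinset.2 ⟨h1.1, h3, h2.2, h4⟩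
    · rw [card_pairFinset hn, Finset.card_image_of_injOn, Nat.card_Icc]
      · omega
      · intro i hi j hj hij
        simp only [Prod.mk.injEq] at hij
        rcases lt_trichotomy i j with hlt | heq | hlt
        · have := h.order i hi j hj hlt; omega
        · exact heq
        · have := h.order j hj i hi hlt; omega
  have hmem : (p, q) ∈ pairFinset n :=
    mem_pairFinset.2 ⟨hp, hpq, hq, by simpa using hne⟩
  rw [← himg, Finset.mem_image] at hmem
  obtain ⟨i, hi, he⟩ := hmem
  rw [Prod.mk.injEq] at he
  exact ⟨i, hi, he⟩

theorem rank_eq (hn : 6 ≤ n) : n * (n - 3) / 2 = 2 * n - 5 + ((n - 3).choose 2 - 1) := by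
  obtain ⟨k, rfl⟩ := Nat.exists_eq_add_of_le' hn
  have h1 : k + 6 - 3 = k + 3 := rfl
  rw [h1]
  have h2 : (k + 3).choose 2 * 2 = (k + 3) * (k + 2) := by
    rw [Nat.choose_two_right, Nat.div_mul_cancel]
    · rfl
    · exact (Nat.even_mul_pred_self (k + 3)).two_dvd
  have h3 : 3 ≤ (k + 3).choose 2 := by nlinarith
  have h4 : (k + 6) * (k + 3) = (2 * (k + 6) - 5 + ((k + 3).choose 2 - 1)) * 2 := by
    have h5 : 2 * (k + 6) - 5 + ((k + 3).choose 2 - 1) = 2 * k + 6 + (k + 3).choose 2 := by omega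
    rw [h5]
    linarith
  omega

/-- The second columns of the polytabloids in the tuple `y`. -/
def columnPair (n : ℕ) (b c : ℕ → ℕ) (i : ℕ) : ℕ × ℕ :=
  if i ≤ n - 2 then (n - i, n)
  else if i ≤ 2 * n - 5 then (n - 1 - (i - (n - 2)), n - 1)
  else (b (i - (2 * n - 5)), c (i - (2 * n - 5)))

theorem yTuple_eq (n : ℕ) (b c : ℕ → ℕ) (i : ℕ) :
    yTuple n b c i = pt n (columnPair n b c i).1 (columnPair n b c i).2 := by
  unfold yTuple columnPair
  split_ifs <;> rfl

theorem columnPair_of_le (b c : ℕ → ℕ) {i : ℕ} (hi : i ≤ n - 2) :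
    columnPair n b c i = (n - i, n) := if_pos hi

theorem columnPair_sub_one (hn : 6 ≤ n) (b c : ℕ → ℕ) :
    columnPair n b c (n - 1) = (n - 2, n - 1) := by
  rw [columnPair, if_neg (by omega), if_pos (by omega), Prod.mk.injEq]
  omega

variable {b c : ℕ → ℕ} (hbc : IsPairList n b c)

include hbc

theorem IsPairList.columnPair_mem (hn : 6 ≤ n) {i : ℕ}
    (hi : i ∈ Finset.Icc 1 (n * (n - 3) / 2)) :
    2 ≤ (columnPair n b c i).1 ∧ (columnPair n b c i).1 < (columnPair n b c i).2 ∧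
      (columnPair n b c i).2 ≤ n ∧
      ¬ ((columnPair n b c i).1 = 2 ∧ (columnPair n b c i).2 = 3) := by
  rw [rank_eq hn, Finset.mem_Icc] at hi
  unfold columnPair
  split_ifs with h1 h2
  · simp only; omega
  · simp only; omega
  · have := hbc.mem (i - (2 * n - 5)) (Finset.mem_Icc.2 (by omega))
    simp only [Finset.mem_Icc, ne_eq, Prod.mk.injEq] at this ⊢
    omega

theorem IsPairList.columnPair_order (hn : 6 ≤ n) {i j : ℕ}
    (hi : i ∈ Finset.Icc 1 (n * (n - 3) / 2)) (hj : j ∈ Finset.Icc 1 (n * (n - 3) / 2))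
    (hij : i < j) :
    (columnPair n b c j).2 < (columnPair n b c i).2 ∨
      ((columnPair n b c i).2 = (columnPair n b c j).2 ∧
        (columnPair n b c j).1 < (columnPair n b c i).1) := by
  rw [rank_eq hn, Finset.mem_Icc] at hi hj
  have hm : 2 * n - 5 < j → c (j - (2 * n - 5)) ≤ n - 2 := fun h =>
    (Finset.mem_Icc.1 (hbc.mem (j - (2 * n - 5)) (Finset.mem_Icc.2 (by omega))).2.1).2
  unfold columnPair
  split_ifs with h1 h2 h3 h4 h5 h6 <;> dsimp only <;> try omega
  exact hbc.order _ (Finset.mem_Icc.2 (by omega)) _ (Finset.mem_Icc.2 (by omega)) (by omega)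

theorem IsPairList.exists_columnPair_eq (hn : 6 ≤ n) {p q : ℕ} (hp : 2 ≤ p) (hpq : p < q)
    (hq : q ≤ n) (hne : ¬ (p = 2 ∧ q = 3)) :
    ∃ i ∈ Finset.Icc 1 (n * (n - 3) / 2), columnPair n b c i = (p, q) := by
  rw [rank_eq hn]
  by_cases h1 : q = n
  · refine ⟨n - p, Finset.mem_Icc.2 (by omega), ?_⟩
    rw [columnPair, if_pos (by omega), Prod.mk.injEq]
    omega
  by_cases h2 : q = n - 1
  · refine ⟨n - 1 - p + (n - 2), Finset.mem_Icc.2 (by omega), ?_⟩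
    rw [columnPair, if_neg (by omega), if_pos (by omega), Prod.mk.injEq]
    omega
  · obtain ⟨i, hi, rfl, rfl⟩ := hbc.exists_eq (by omega) hp hpq (by omega) hne
    rw [Finset.mem_Icc] at hi
    refine ⟨2 * n - 5 + i, Finset.mem_Icc.2 (by omega), ?_⟩
    rw [columnPair, if_neg (by omega), if_neg (by omega)]
    simp

end PairList

/-! ### The tuples in terms of edge vectors, and why they generate -/

section Tuples

theorem neg_one_pow_of_mod_zero {k : ℕ} (h : k % 2 = 0) : (-1 : ℤ) ^ k = 1 :=
  Even.neg_one_pow (Nat.even_iff.2 h)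

theorem neg_one_pow_of_mod_one {k : ℕ} (h : k % 2 = 1) : (-1 : ℤ) ^ k = -1 :=
  Odd.neg_one_pow (Nat.odd_iff.2 h)

theorem neg_one_pow_smul_eq_zero {M : Type*} [AddCommGroup M] {k : ℕ} {v : M}
    (h : (-1 : ℤ) ^ k • v = 0) : v = 0 := by
  rcases neg_one_pow_eq_or ℤ k with e | e <;> rw [e] at h <;> simpa using h

theorem validPair {p q : ℕ} (hn : 6 ≤ n) (hp : 1 ≤ p) (hpq : p < q) (hq : q ≤ n) :
    ValidPair n p q :=
  ⟨by omega, Finset.mem_Icc.2 (by omega), Finset.mem_Icc.2 (by omega), by omega⟩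

/-- Up to sign, the element `zElement` in terms of the normalized polytabloids. -/
def zVector (n : ℕ) : Specht (shape n) n :=
  pairVector n 3 n + pairVector n (n - 1) n + (n - 3 : ℤ) • pairVector n 3 (n - 1)

theorem zElement_eq (hn : 6 ≤ n) : zElement n = (-1 : ℤ) ^ n • zVector n := by
  have h3 : ((n - 3 : ℕ) : ℤ) = n - 3 := by omega
  rw [zElement, zVector, h3, pt_eq (validPair hn (by omega) (by omega) le_rfl) (by omega),
    pt_eq (validPair hn (by omega) (by omega) le_rfl) (by omega),
    pt_eq (validPair hn (by omega) (by omega) (by omega)) (by omega)]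
  rcases Nat.mod_two_eq_zero_or_one n with h | h
  · rw [neg_one_pow_of_mod_zero h, neg_one_pow_of_mod_zero (k := 3 + n + 1) (by omega),
      neg_one_pow_of_mod_zero (k := n - 1 + n + 1) (by omega),
      neg_one_pow_of_mod_one (k := 3 + (n - 1) + 1) (by omega)]
    module
  · rw [neg_one_pow_of_mod_one h, neg_one_pow_of_mod_one (k := 3 + n + 1) (by omega),
      neg_one_pow_of_mod_zero (k := n - 1 + n + 1) (by omega),
      neg_one_pow_of_mod_zero (k := 3 + (n - 1) + 1) (by omega)]
    module

variable (b c : ℕ → ℕ)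

theorem xTuple_one_of_odd (hn : 6 ≤ n) (ho : Odd n) : xTuple n b c 1 = pairVector n 3 4 := by
  rw [xTuple, if_pos rfl, if_pos ho, pt_eq (validPair hn (by omega) (by omega) (by omega))
    (by omega), neg_one_pow_of_mod_zero rfl, one_smul]

theorem xTuple_one_of_even (hn : 6 ≤ n) (he : Even n) :
    xTuple n b c 1 = pairVector n 3 n + (((n - 2) / 2 : ℕ) : ℤ) • pairVector n 3 4 := by
  have h := Nat.even_iff.1 he
  rw [xTuple, if_pos rfl, if_neg (Nat.not_odd_iff_even.2 he),
    pt_eq (validPair hn (by omega) (by omega) (by omega)) (by omega),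
    pt_eq (validPair hn (by omega) (by omega) (by omega)) (by omega),
    neg_one_pow_of_mod_zero (by omega), one_smul, neg_one_pow_of_mod_zero rfl, one_smul]

theorem xTuple_of_le (hn : 6 ≤ n) {i : ℕ} (h2 : 2 ≤ i) (hi : i ≤ n - 2) :
    xTuple n b c i =
      (-1 : ℤ) ^ i • (pairVector n (n - i) (n - 1) - pairVector n 1 (n - 1)) := by
  rw [xTuple, if_neg (by omega), if_pos hi,
    pt_eq (validPair hn (by omega) (by omega) (by omega)) (by omega),
    pt_eq (validPair hn (by omega) (by omega) (by omega)) (by omega), smul_smul, ← pow_add]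
  rcases Nat.mod_two_eq_zero_or_one i with h | h
  · rw [neg_one_pow_of_mod_zero h, neg_one_pow_of_mod_one (k := n - i + (1 + (n - 1) + 1))
      (by omega), neg_one_pow_of_mod_zero (k := n - i + (n - 1) + 1) (by omega)]
    module
  · rw [neg_one_pow_of_mod_one h, neg_one_pow_of_mod_zero (k := n - i + (1 + (n - 1) + 1))
      (by omega), neg_one_pow_of_mod_one (k := n - i + (n - 1) + 1) (by omega)]
    module

theorem ptRho_eq_cycleSum (hn : 6 ≤ n) {p q : ℕ} (hp : 2 ≤ p) (hpq : p < q) (hq : q ≤ n)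
    (hne : ¬ (p = 2 ∧ q = 3)) :
    ptRho n p q = (-1 : ℤ) ^ (p + q + 1) • cycleSum (pairVector n) p q :=
  ptRho_eq (validPair hn (by omega) hpq hq) hp hpq hne

theorem ptRho_sub_two (hn : 6 ≤ n) :
    ptRho n (n - 2) (n - 1) = cycleSum (pairVector n) (n - 2) (n - 1) := by
  rw [ptRho_eq_cycleSum hn (by omega) (by omega) (by omega) (by omega),
    neg_one_pow_of_mod_zero (by omega), one_smul]

theorem xTuple_sub_one_of_odd (hn : 6 ≤ n) (ho : Odd n) :
    xTuple n b c (n - 1) =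
      (((n - 3) / 2 : ℕ) : ℤ) • cycleSum (pairVector n) (n - 2) (n - 1) +
        (((n - 1) / 2 : ℕ) : ℤ) • zVector n := by
  rw [xTuple, if_neg (by omega), if_neg (by omega), if_pos (by omega), if_pos ho,
    ptRho_sub_two hn, zElement_eq hn, ho.neg_one_pow]
  module

theorem xTuple_sub_one_of_even (hn : 6 ≤ n) (he : Even n) :
    xTuple n b c (n - 1) = cycleSum (pairVector n) (n - 2) (n - 1) + zVector n := by
  rw [xTuple, if_neg (by omega), if_neg (by omega), if_pos (by omega),
    if_neg (Nat.not_odd_iff_even.2 he), ptRho_sub_two hn, zElement_eq hn, he.neg_one_pow, one_smul]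

variable {b c} (hbc : IsPairList n b c)

include hbc

theorem xTuple_of_ge (hn : 6 ≤ n) {i : ℕ} (hi : i ∈ Finset.Icc n (n * (n - 3) / 2)) :
    xTuple n b c i = (-1 : ℤ) ^ ((columnPair n b c i).1 + (columnPair n b c i).2 + 1) •
      cycleSum (pairVector n) (columnPair n b c i).1 (columnPair n b c i).2 := by
  rw [Finset.mem_Icc] at hi
  obtain ⟨h1, h2, h3, h4⟩ := hbc.columnPair_mem hn (i := i) (Finset.mem_Icc.2 (by omega))
  rw [← ptRho_eq_cycleSum hn h1 h2 h3 h4]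
  unfold xTuple columnPair
  rw [if_neg (show ¬ i = 1 by omega), if_neg (show ¬ i ≤ n - 2 by omega),
    if_neg (show ¬ i = n - 2 + 1 by omega), if_neg (show ¬ i ≤ n - 2 by omega)]
  split_ifs <;> rfl

theorem yTuple_eq_smul (hn : 6 ≤ n) {i : ℕ} (hi : i ∈ Finset.Icc 1 (n * (n - 3) / 2)) :
    yTuple n b c i = (-1 : ℤ) ^ ((columnPair n b c i).1 + (columnPair n b c i).2 + 1) •
      pairVector n (columnPair n b c i).1 (columnPair n b c i).2 := by
  obtain ⟨h1, h2, h3, h4⟩ := hbc.columnPair_mem hn hi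
  rw [yTuple_eq, pt_eq (validPair hn (by omega) h2 h3) h2]

/-- Modulo `W` the edge vectors form a pair function that vanishes on every edge {p, q} with 2 ≤ p <
q other than {2, 3}. -/
theorem eq_top_of_yTuple_mem (hn : 6 ≤ n) (W : Submodule ℤ (Specht (shape n) n))
    (hW : ∀ i ∈ Finset.Icc 1 (n * (n - 3) / 2), yTuple n b c i ∈ W) : W = ⊤ := by
  refine span_pairVector (by omega) W ?_
  have hg := (isPairFunction_pairVector (n := n) (by omega)).map W.mkQ.toAddMonoidHom
  have := hg.eq_zero_of_ge_two (by omega) ?_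
  · intro p hp q hq hpq
    exact (Submodule.Quotient.mk_eq_zero W).1 (this p hp q hq hpq)
  · intro p q hp hpq hq hne
    obtain ⟨i, hi, he⟩ := hbc.exists_columnPair_eq hn hp hpq hq hne
    have h := hW i hi
    rw [yTuple_eq_smul hbc hn hi, he, ← Submodule.Quotient.mk_eq_zero,
      Submodule.Quotient.mk_smul] at h
    exact neg_one_pow_smul_eq_zero h

theorem eq_top_of_xTuple_mem (hn : 6 ≤ n) (W : Submodule ℤ (Specht (shape n) n))
    (hW : ∀ i ∈ Finset.Icc 1 (n * (n - 3) / 2), xTuple n b c i ∈ W) : W = ⊤ := by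
  refine span_pairVector (by omega) W ?_
  have hg := (isPairFunction_pairVector (n := n) (by omega)).map W.mkQ.toAddMonoidHom
  set g : ℕ → ℕ → Specht (shape n) n ⧸ W := fun p q => W.mkQ.toAddMonoidHom (pairVector n p q)
    with g_def
  have hcyc : ∀ p q, W.mkQ (cycleSum (pairVector n) p q) = cycleSum g p q := by
    intro p q
    simp only [cycleSum, map_add, map_sub]
    rfl
  have hm := rank_eq hn
  have hx : ∀ i ∈ Finset.Icc 1 (n * (n - 3) / 2), W.mkQ (xTuple n b c i) = 0 := fun i hi =>
    (Submodule.Quotient.mk_eq_zero W).2 (hW i hi)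
  have hc : ∀ p q, 2 ≤ p → p < q → q ≤ n - 1 → ¬ (p = 2 ∧ q = 3) →
      ¬ (p = n - 2 ∧ q = n - 1) → cycleSum g p q = 0 := by
    intro p q hp hpq hq hne hne'
    obtain ⟨i, hi, he⟩ := hbc.exists_columnPair_eq hn hp hpq (by omega) hne
    -- Indices up to n-2 belong to edges at n, and index n-1 to {n-2, n-1}; both are excluded here.
    -- So the vector of x at this index is a plain 4-cycle sum.
    have hin : n ≤ i := by
      by_contra hlt
      by_cases h1 : i = n - 1
      · rw [h1, columnPair_sub_one hn, Prod.mk.injEq] at he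
        exact hne' ⟨he.1.symm, he.2.symm⟩
      · rw [columnPair_of_le b c (by omega), Prod.mk.injEq] at he
        omega
    have h := hx i hi
    rw [xTuple_of_ge hbc hn (Finset.mem_Icc.2 ⟨hin, (Finset.mem_Icc.1 hi).2⟩), he, map_smul,
      hcyc] at h
    exact neg_one_pow_smul_eq_zero h
  have hk : ∀ k, 2 ≤ k → k ≤ n - 2 → g k (n - 1) = g 1 (n - 1) := by
    intro k hk hk'
    have h := hx (n - k) (Finset.mem_Icc.2 (by omega))
    rw [xTuple_of_le b c hn (by omega) (by omega), map_smul] at h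
    have h' := neg_one_pow_smul_eq_zero h
    rw [show n - (n - k) = k by omega, map_sub] at h'
    exact sub_eq_zero.1 h'
  obtain ⟨s, r, t, hs, hr, ht⟩ := hg.exists_const hn hc hk
  obtain ⟨e1, e2, e3⟩ := hg.const_relations hn hs hr ht
  have hv : cycleSum g (n - 2) (n - 1) = s - r := by
    rw [cycleSum, secondLetter, if_neg (by omega), ht _ (by omega) (by omega),
      ht _ (by omega) (by omega), hg.comm (n - 2) 2, hr _ (by omega) (by omega),
      hs _ _ (by omega) (by omega) (by omega)]
    abel
  have hz : W.mkQ (zVector n) = g 3 n + g (n - 1) n + (n - 3 : ℤ) • t := by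
    rw [← ht 3 (by omega) (by omega), zVector, map_add, map_add, map_smul]
    rfl
  have x1 := hx 1 (Finset.mem_Icc.2 (by omega))
  have xn := hx (n - 1) (Finset.mem_Icc.2 (by omega))
  have key : s = 0 ∧ r = 0 ∧ t = 0 := by
    rcases Nat.even_or_odd n with he | ho
    · rw [xTuple_one_of_even b c hn he, map_add, map_smul] at x1
      rw [xTuple_sub_one_of_even b c hn he, map_add, hz, hcyc] at xn
      change g 3 n + _ • g 3 4 = 0 at x1
      -- The edge {3, 4} lies in the family with value `s` only if 4 ≤ n-3, which fails exactly for
      -- n = 6 among even n.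
      by_cases h6 : n = 6
      · subst h6
        have h34 : g 3 4 = r := hr 3 (by omega) (by omega)
        rw [h34] at x1
        refine eq_zero_of_six_relations (u := g 5 6) (w := g 3 6) x1 ?_ ?_ ?_ hv ?_
        · exact e1
        · exact e2
        · exact e3
        · exact xn
      · obtain ⟨j, rfl⟩ : ∃ j, n = 2 * j + 8 := by
          obtain ⟨j, rfl⟩ := he
          exact ⟨j - 4, by omega⟩
        have h34 : g 3 4 = s := hs 3 4 (by omega) (by omega) (by omega)
        rw [h34, show (2 * j + 8 - 2) / 2 = j + 3 by omega] at x1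
        rw [sum_range_cast _ ((2 * j + 5) * (j + 2)) (by
          rw [show 2 * j + 8 - 3 = 2 * j + 5 by omega, show 2 * j + 5 - 1 = 2 * j + 4 by omega]
          ring)] at e3
        push_cast at x1 e1 e2 e3 xn
        exact eq_zero_of_even_relations (j : ℤ) x1 e1 e2 e3 hv xn
    · rw [xTuple_one_of_odd b c hn ho] at x1
      rw [xTuple_sub_one_of_odd b c hn ho, map_add, map_smul, map_smul, hz, hcyc] at xn
      obtain ⟨j, rfl⟩ : ∃ j, n = 2 * j + 7 := by
        obtain ⟨j, rfl⟩ := ho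
        exact ⟨j - 3, by omega⟩
      have h34 : s = 0 := by
        rw [← hs 3 4 (by omega) (by omega) (by omega)]
        exact x1
      rw [show (2 * j + 7 - 3) / 2 = j + 2 by omega, show (2 * j + 7 - 1) / 2 = j + 3 by omega]
        at xn
      push_cast at e1 e2 xn
      rw [show ((2 * j + 7 : ℕ) : ℤ) = 2 * j + 7 by push_cast; ring] at e3
      exact ⟨h34, eq_zero_of_odd_relations (j : ℤ) h34 e1 e2 e3 hv xn⟩
  obtain ⟨rfl, rfl, rfl⟩ := key
  intro p hp q hq hpq
  exact (Submodule.Quotient.mk_eq_zero W).1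
    (hg.eq_zero_of_const_zero hn hs hr ht p hp q hq hpq)

end Tuples

/-! ### Values of the form on the two tuples -/

section FormValues

/-- Values of the form against a normalized polytabloid. -/
def pairForm (n r s : ℕ) : Specht (shape n) n →ₗ[ℤ] ℤ :=
  (spechtForm (shape n) n).flip (pairVector n r s)

theorem pairForm_apply (r s : ℕ) (v : Specht (shape n) n) :
    pairForm n r s v = spechtForm (shape n) n v (pairVector n r s) := rfl

theorem pairForm_pairVector (hn : 6 ≤ n) {p q r s : ℕ} (hp : 1 ≤ p) (hpq : p < q) (hq : q ≤ n)
    (hr : 1 ≤ r) (hrs : r < s) (hs : s ≤ n) :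
    pairForm n r s (pairVector n p q) = 2 * (n - 4).factorial * gramValue n p q r s := by
  apply spechtForm_pairVector (by omega) <;> first | omega | (rw [Finset.mem_Icc]; omega)

theorem pairForm_pairVector_of_ne (hn : 6 ≤ n) {p q r s : ℕ} (hp : 1 ≤ p) (hq : 1 ≤ q)
    (hpq : p ≠ q) (hpn : p ≤ n) (hqn : q ≤ n) (hr : 1 ≤ r) (hrs : r < s) (hs : s ≤ n) :
    pairForm n r s (pairVector n p q) = 2 * (n - 4).factorial * gramValue n p q r s := by
  apply spechtForm_pairVector (by omega) <;> first | omega | (rw [Finset.mem_Icc]; omega)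

/-- Each vertex of the 4-cycle carries total weight zero, so only equality of edges survives. The
edges at 1 are invisible to {r, s}, and {p, `secondLetter p`} is {2, p} unless it is the excluded
{2, 3}. -/
theorem pairForm_cycleSum (hn : 6 ≤ n) {p q r s : ℕ} (hp : 2 ≤ p) (hpq : p < q) (hq : q ≤ n)
    (hr : 2 ≤ r) (hrs : r < s) (hs : s ≤ n)
    (hrs' : ¬ (r = 2 ∧ s = 3)) :
    pairForm n r s (cycleSum (pairVector n) p q) = 2 * (n - 4).factorial *
      ((n - 1) * (n - 2) * ((if p = r ∧ q = s then 1 else 0) - if r = 2 ∧ s = p then 1 else 0)) := by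
  have h2 : 2 ≤ secondLetter p ∧ secondLetter p ≤ 3 ∧ secondLetter p ≠ p ∧
      (p = 2 → secondLetter p = 3) ∧ (p ≠ 2 → secondLetter p = 2) := by
    unfold secondLetter
    split_ifs <;> omega
  rw [cycleSum, map_add, map_sub, map_sub,
    pairForm_pairVector_of_ne hn (by omega) (by omega) (by omega) (by omega) hq (by omega) hrs hs,
    pairForm_pairVector_of_ne hn (by omega) (by omega) (by omega) (by omega) hq (by omega) hrs hs,
    pairForm_pairVector_of_ne hn (p := p) (q := secondLetter p) (by omega) (by omega) (by omega)
      (by omega) (by omega) (by omega) hrs hs,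
    pairForm_pairVector_of_ne hn (p := 1) (q := secondLetter p) (by omega) (by omega) (by omega)
      (by omega) (by omega) (by omega) hrs hs]
  generalize secondLetter p = σ at h2
  have key : ((if p = r ∧ q = s then 1 else 0) + (if p = s ∧ q = r then 1 else 0) -
      (if p = r ∧ σ = s then 1 else 0) - (if p = s ∧ σ = r then 1 else 0) : ℤ) =
      (if p = r ∧ q = s then 1 else 0) - (if r = 2 ∧ s = p then 1 else 0) := by
    split_ifs <;> omega
  rw [← key]
  simp (disch := omega) only [gramValue, if_neg (show ¬ 1 = r by omega),
    if_neg (show ¬ 1 = s by omega), if_neg (show ¬ (1 = r ∧ q = s) by omega),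
    if_neg (show ¬ (1 = s ∧ q = r) by omega), if_neg (show ¬ (1 = r ∧ σ = s) by omega),
    if_neg (show ¬ (1 = s ∧ σ = r) by omega)]
  ring

/-- The values of `zVector` against the normalized polytabloids. -/
theorem pairForm_zVector (hn : 6 ≤ n) {r s : ℕ} (hr : 1 ≤ r) (hrs : r < s) (hs : s ≤ n) :
    pairForm n r s (zVector n) = 2 * (n - 4).factorial *
      (gramValue n 3 n r s + gramValue n (n - 1) n r s +
        (n - 3) * gramValue n 3 (n - 1) r s) := by
  rw [zVector, map_add, map_add, map_smul,
    pairForm_pairVector hn (by omega) (by omega) (by omega) hr hrs hs,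
    pairForm_pairVector hn (by omega) (by omega) (by omega) hr hrs hs,
    pairForm_pairVector hn (by omega) (by omega) (by omega) hr hrs hs, smul_eq_mul]
  ring

/-- The edge weights of z sum to n-1, and its vertex weights are n-2 at 3 and at n-1, and 2 at n.
The factor n-1 is thus common, and for even n the bracket is even. -/
theorem exists_gramValue_sum_eq (n r s : ℕ) : ∃ a e : ℤ,
    gramValue n 3 n r s + gramValue n (n - 1) n r s + (n - 3) * gramValue n 3 (n - 1) r s =
      (n - 1) * (2 * a + (n - 2) * e) := by
  let D : ℕ → ℤ := fun k => (if k = r then 1 else 0) + (if k = s then 1 else 0)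
  let E : ℕ → ℕ → ℤ := fun p q =>
    (if p = r ∧ q = s then 1 else 0) + (if p = s ∧ q = r then 1 else 0)
  refine ⟨1 - D n, E 3 n + E (n - 1) n + (n - 3) * E 3 (n - 1) - D 3 - D (n - 1), ?_⟩
  simp only [gramValue, D, E]
  ring

/-- The constant part 2(n-1) cancels against the weight 2 at vertex n. If r is 3 or n-1, the vertex
weight n-2 there cancels against the edge {r, n} of z. So z does not disturb the first n-2 columns.
-/
theorem gramValue_sum_eq_zero (hn : 6 ≤ n) {r : ℕ} (hr : 2 ≤ r) (hrn : r ≤ n - 1) :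
    gramValue n 3 n r n + gramValue n (n - 1) n r n + (n - 3) * gramValue n 3 (n - 1) r n = 0 := by
  by_cases h3 : r = 3
  · subst h3
    simp (disch := omega) only [gramValue, if_true, and_self, if_neg]
    ring
  by_cases h1 : r = n - 1
  · subst h1
    simp (disch := omega) only [gramValue, if_true, and_self, if_neg]
    ring
  · simp (disch := omega) only [gramValue, if_true, if_neg]
    ring

theorem gramValue_sum_pivot (hn : 6 ≤ n) :
    gramValue n 3 n (n - 2) (n - 1) + gramValue n (n - 1) n (n - 2) (n - 1) +
      (n - 3) * gramValue n 3 (n - 1) (n - 2) (n - 1) = -((n - 1) * (n - 4)) := by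
  simp (disch := omega) only [gramValue, if_true, if_neg]
  ring

/-- The `i`-th diagonal value of the trigonalized form, divided by `2 * (n - 4)!`. -/
def diagFactor (n i : ℕ) : ℕ :=
  if i = 1 then if Odd n then 2 else 1
  else if i ≤ n - 2 then n - 1
  else if i = n - 1 then (if Even n then 2 else 1) * (n - 1)
  else (n - 2) * (n - 1)

/-- Values of an element `v` that serves as the `i`-th vector of a trigonalizing basis against
the normalized polytabloids. -/
structure IsPivot (n : ℕ) (b c : ℕ → ℕ) (i : ℕ) (v : Specht (shape n) n) : Prop where
  dvd : ∀ r s, 2 ≤ r → r < s → s ≤ n → ¬ (r = 2 ∧ s = 3) →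
    2 * ((n - 4).factorial : ℤ) * diagFactor n i ∣ pairForm n r s v
  lower : ∀ j ∈ Finset.Icc 1 (n * (n - 3) / 2), j < i →
    pairForm n (columnPair n b c j).1 (columnPair n b c j).2 v = 0
  diag : (pairForm n (columnPair n b c i).1 (columnPair n b c i).2 v).natAbs =
    diagFactor n i * (2 * (n - 4).factorial)

theorem natAbs_eq_of_eq {z : ℤ} {d N : ℕ} (h : z = 2 * N * d ∨ z = -(2 * N * d)) :
    z.natAbs = d * (2 * N) := by
  rcases h with rfl | rfl
  · rw [mul_comm, Int.natAbs_mul, Int.natAbs_mul]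
    simp
  · rw [Int.natAbs_neg, mul_comm, Int.natAbs_mul, Int.natAbs_mul]
    simp

variable (b c : ℕ → ℕ)

theorem isPivot_one_of_odd (hn : 6 ≤ n) (ho : Odd n) : IsPivot n b c 1 (xTuple n b c 1) := by
  have hd : diagFactor n 1 = 2 := by rw [diagFactor, if_pos rfl, if_pos ho]
  have h2 : (2 : ℤ) ∣ n - 1 := by obtain ⟨j, rfl⟩ := ho; exact ⟨j, by push_cast; ring⟩
  rw [xTuple_one_of_odd b c hn ho]
  refine ⟨fun r s hr hrs hs _ => ?_, fun j hj hj1 => ?_, ?_⟩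
  · rw [pairForm_pairVector hn (by omega) (by omega) (by omega) (by omega) hrs hs, hd]
    refine mul_dvd_mul_left _ ?_
    rw [gramValue]
    exact dvd_add (dvd_sub dvd_rfl (h2.mul_right _)) ((h2.mul_right _).mul_right _)
  · rw [Finset.mem_Icc] at hj
    omega
  · rw [columnPair_of_le b c (by omega), hd]
    simp only
    rw [pairForm_pairVector hn (by omega) (by omega) (by omega) (by omega) (by omega) le_rfl]
    apply natAbs_eq_of_eq
    left
    simp (disch := omega) only [gramValue, if_neg]
    push_cast
    ring

theorem isPivot_one_of_even (hn : 6 ≤ n) (he : Even n) : IsPivot n b c 1 (xTuple n b c 1) := by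
  have hd : diagFactor n 1 = 1 := by
    rw [diagFactor, if_pos rfl, if_neg (Nat.not_odd_iff_even.2 he)]
  have h2 : (((n - 2) / 2 : ℕ) : ℤ) * 2 = n - 2 := by obtain ⟨j, rfl⟩ := he; omega
  rw [xTuple_one_of_even b c hn he]
  refine ⟨fun r s hr hrs hs _ => ?_, fun j hj hj1 => ?_, ?_⟩
  · rw [map_add, map_smul, pairForm_pairVector hn (by omega) (by omega) (by omega) (by omega) hrs hs,
      pairForm_pairVector hn (by omega) (by omega) (by omega) (by omega) hrs hs, hd, Nat.cast_one,
      mul_one]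
    exact dvd_add (dvd_mul_right _ _) ((dvd_mul_right _ _).mul_left _)
  · rw [Finset.mem_Icc] at hj
    omega
  · rw [columnPair_of_le b c (by omega), hd]
    simp only
    rw [map_add, map_smul,
      pairForm_pairVector hn (by omega) (by omega) (by omega) (by omega) (by omega) le_rfl,
      pairForm_pairVector hn (by omega) (by omega) (by omega) (by omega) (by omega) le_rfl]
    apply natAbs_eq_of_eq
    left
    simp (disch := omega) only [gramValue, if_neg, if_true, smul_eq_mul]
    rw [Nat.cast_one]
    -- The edge {3, n} contributes 3-n and the disjoint edge {3, 4} contributes 2 · (n-2)/2, with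
    -- sum 1.
    linear_combination (2 * ((n - 4).factorial : ℤ)) * h2

/-- In the difference of the edges {n-i, n-1} and {1, n-1} the constants and the incidences at n-1
cancel, and test edges avoid 1. Only incidence with n-i, and equality with {n-i, n-1}, are left;
among the first columns, those of the edges {n-j, n}, this first occurs at j = i. -/
theorem isPivot_of_le (hn : 6 ≤ n) {i : ℕ} (h2 : 2 ≤ i) (hi : i ≤ n - 2) :
    IsPivot n b c i (xTuple n b c i) := by
  have hd : (diagFactor n i : ℤ) = n - 1 := by
    rw [diagFactor, if_neg (by omega), if_pos hi]
    omega
  have hval : ∀ r s, 2 ≤ r → r < s → s ≤ n → pairForm n r s (xTuple n b c i) =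
      2 * (n - 4).factorial * (n - 1) * ((-1 : ℤ) ^ i *
        ((n - 2) * (if n - i = r ∧ n - 1 = s then 1 else 0) -
          ((if n - i = r then 1 else 0) + (if n - i = s then 1 else 0)))) := by
    intro r s hr hrs hs
    rw [xTuple_of_le b c hn h2 hi, map_smul, map_sub,
      pairForm_pairVector hn (by omega) (by omega) (by omega) (by omega) hrs hs,
      pairForm_pairVector hn (by omega) (by omega) (by omega) (by omega) hrs hs, smul_eq_mul]
    simp only [gramValue, if_neg (show ¬ 1 = r by omega), if_neg (show ¬ 1 = s by omega),
      if_neg (show ¬ (1 = r ∧ n - 1 = s) by omega), if_neg (show ¬ (1 = s ∧ n - 1 = r) by omega),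
      if_neg (show ¬ (n - i = s ∧ n - 1 = r) by omega)]
    ring
  refine ⟨fun r s hr hrs hs _ => ?_, fun j hj hj1 => ?_, ?_⟩
  · rw [hval r s hr hrs hs, hd]
    exact dvd_mul_right _ _
  · rw [Finset.mem_Icc] at hj
    rw [columnPair_of_le b c (by omega)]
    simp only
    rw [hval _ _ (by omega) (by omega) le_rfl]
    simp (disch := omega) only [if_neg]
    ring
  · rw [columnPair_of_le b c hi]
    simp only
    apply natAbs_eq_of_eq
    rw [hval _ _ (by omega) (by omega) le_rfl, hd]
    simp (disch := omega) only [if_neg, if_true]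
    rcases neg_one_pow_eq_or ℤ i with h | h <;> rw [h]
    · right; ring
    · left; ring

theorem isPivot_sub_one_of_odd (hn : 6 ≤ n) (ho : Odd n) :
    IsPivot n b c (n - 1) (xTuple n b c (n - 1)) := by
  have hd : (diagFactor n (n - 1) : ℤ) = n - 1 := by
    rw [diagFactor, if_neg (by omega), if_neg (by omega), if_pos rfl,
      if_neg (Nat.not_even_iff_odd.2 ho)]
    omega
  have h1 : (((n - 1) / 2 : ℕ) : ℤ) * 2 = n - 1 := by obtain ⟨j, rfl⟩ := ho; omega
  have h3 : (((n - 3) / 2 : ℕ) : ℤ) * 2 = n - 3 := by obtain ⟨j, rfl⟩ := ho; omega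
  rw [xTuple_sub_one_of_odd b c hn ho]
  refine ⟨fun r s hr hrs hs hne => ?_, fun j hj hj1 => ?_, ?_⟩
  · rw [map_add, map_smul, map_smul,
      pairForm_cycleSum hn (by omega) (by omega) (by omega) hr hrs hs hne,
      pairForm_zVector hn (by omega) hrs hs, hd]
    obtain ⟨a, e, h⟩ := exists_gramValue_sum_eq n r s
    rw [h]
    refine dvd_add (Dvd.dvd.mul_left ?_ _) (Dvd.dvd.mul_left ?_ _)
    · exact mul_dvd_mul_left _ ((dvd_mul_right _ _).mul_right _)
    · exact mul_dvd_mul_left _ (dvd_mul_right _ _)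
  · rw [Finset.mem_Icc] at hj
    rw [columnPair_of_le b c (by omega)]
    simp only
    rw [map_add, map_smul, map_smul,
      pairForm_cycleSum hn (by omega) (by omega) (by omega) (by omega) (by omega) le_rfl (by omega),
      pairForm_zVector hn (by omega) (by omega) le_rfl,
      gramValue_sum_eq_zero hn (by omega) (by omega)]
    simp (disch := omega) only [if_neg]
    simp
  · rw [columnPair_sub_one hn]
    simp only
    apply natAbs_eq_of_eq
    left
    rw [map_add, map_smul, map_smul,
      pairForm_cycleSum hn (by omega) (by omega) (by omega) (by omega) (by omega) (by omega)
        (by omega),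
      pairForm_zVector hn (by omega) (by omega) (by omega), gramValue_sum_pivot hn, hd]
    simp (disch := omega) only [if_neg, if_true, and_self, smul_eq_mul]
    -- The weights (n-3)/2 and (n-1)/2 are chosen so that (n-2)(n-3) - (n-1)(n-4) = 2 makes the
    -- diagonal factor exactly n-1.
    linear_combination ((n - 4).factorial : ℤ) * (n - 1) * ((n - 2) * h3 - (n - 4) * h1)

theorem isPivot_sub_one_of_even (hn : 6 ≤ n) (he : Even n) :
    IsPivot n b c (n - 1) (xTuple n b c (n - 1)) := by
  have hd : (diagFactor n (n - 1) : ℤ) = (n - 1) * 2 := by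
    rw [diagFactor, if_neg (by omega), if_neg (by omega), if_pos rfl, if_pos he]
    omega
  have h2 : (2 : ℤ) ∣ n - 2 := by obtain ⟨j, rfl⟩ := he; exact ⟨j - 1, by push_cast; ring⟩
  rw [xTuple_sub_one_of_even b c hn he]
  refine ⟨fun r s hr hrs hs hne => ?_, fun j hj hj1 => ?_, ?_⟩
  · rw [map_add,
      pairForm_cycleSum hn (by omega) (by omega) (by omega) hr hrs hs hne,
      pairForm_zVector hn (by omega) hrs hs, hd]
    obtain ⟨a, e, h⟩ := exists_gramValue_sum_eq n r s
    rw [h]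
    refine dvd_add ?_ ?_
    · exact mul_dvd_mul_left _ ((mul_dvd_mul_left _ h2).mul_right _)
    · exact mul_dvd_mul_left _ (mul_dvd_mul_left _ (dvd_add (dvd_mul_right _ _) (h2.mul_right _)))
  · rw [Finset.mem_Icc] at hj
    rw [columnPair_of_le b c (by omega)]
    simp only
    rw [map_add,
      pairForm_cycleSum hn (by omega) (by omega) (by omega) (by omega) (by omega) le_rfl (by omega),
      pairForm_zVector hn (by omega) (by omega) le_rfl,
      gramValue_sum_eq_zero hn (by omega) (by omega)]
    simp (disch := omega) only [if_neg]
    simp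
  · rw [columnPair_sub_one hn]
    simp only
    apply natAbs_eq_of_eq
    left
    rw [map_add,
      pairForm_cycleSum hn (by omega) (by omega) (by omega) (by omega) (by omega) (by omega)
        (by omega),
      pairForm_zVector hn (by omega) (by omega) (by omega), gramValue_sum_pivot hn, hd]
    simp (disch := omega) only [if_neg, if_true, and_self]
    ring

variable {b c} (hbc : IsPairList n b c)

include hbc

theorem isPivot_of_ge (hn : 6 ≤ n) {i : ℕ} (hi : i ∈ Finset.Icc n (n * (n - 3) / 2)) :
    IsPivot n b c i (xTuple n b c i) := by
  have hi' := Finset.mem_Icc.1 hi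
  have hi1 : i ∈ Finset.Icc 1 (n * (n - 3) / 2) := Finset.mem_Icc.2 (by omega)
  obtain ⟨h1, h2, h3, h4⟩ := hbc.columnPair_mem hn hi1
  have hd : (diagFactor n i : ℤ) = (n - 1) * (n - 2) := by
    rw [diagFactor, if_neg (by omega), if_neg (by omega), if_neg (by omega)]
    push_cast [show 2 ≤ n by omega, show 1 ≤ n by omega]
    ring
  rw [xTuple_of_ge hbc hn hi]
  refine ⟨fun r s hr hrs hs hne => ?_, fun j hj hji => ?_, ?_⟩
  · rw [map_smul, pairForm_cycleSum hn h1 h2 h3 hr hrs hs hne, hd]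
    exact (mul_dvd_mul_left _ (dvd_mul_right _ _)).mul_left _
  · obtain ⟨g1, g2, g3, g4⟩ := hbc.columnPair_mem hn hj
    -- The second edge {2, p} detected by the 4-cycle sum has larger entry p < q, so it comes later
    -- in the order and lies above the diagonal.
    have ho := hbc.columnPair_order hn hj hi1 hji
    rw [map_smul, pairForm_cycleSum hn h1 h2 h3 g1 g2 g3 g4, if_neg (by omega),
      if_neg (by omega)]
    simp
  · apply natAbs_eq_of_eq
    rw [map_smul, pairForm_cycleSum hn h1 h2 h3 h1 h2 h3 h4, if_pos ⟨rfl, rfl⟩,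
      if_neg (by omega), hd]
    rcases neg_one_pow_eq_or ℤ ((columnPair n b c i).1 + (columnPair n b c i).2 + 1) with h | h <;>
      rw [h, smul_eq_mul]
    · left; ring
    · right; ring

theorem isPivot_xTuple (hn : 6 ≤ n) {i : ℕ} (hi : i ∈ Finset.Icc 1 (n * (n - 3) / 2)) :
    IsPivot n b c i (xTuple n b c i) := by
  rw [Finset.mem_Icc] at hi
  by_cases h1 : i = 1
  · subst h1
    rcases Nat.even_or_odd n with h | h
    · exact isPivot_one_of_even b c hn h
    · exact isPivot_one_of_odd b c hn h
  by_cases h2 : i ≤ n - 2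
  · exact isPivot_of_le b c hn (by omega) h2
  by_cases h3 : i = n - 1
  · subst h3
    rcases Nat.even_or_odd n with h | h
    · exact isPivot_sub_one_of_even b c hn h
    · exact isPivot_sub_one_of_odd b c hn h
  · exact isPivot_of_ge hbc hn (Finset.mem_Icc.2 (by omega))

theorem spechtForm_yTuple (hn : 6 ≤ n) {j : ℕ} (hj : j ∈ Finset.Icc 1 (n * (n - 3) / 2))
    (v : Specht (shape n) n) :
    spechtForm (shape n) n v (yTuple n b c j) =
        pairForm n (columnPair n b c j).1 (columnPair n b c j).2 v ∨
      spechtForm (shape n) n v (yTuple n b c j) =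
        -pairForm n (columnPair n b c j).1 (columnPair n b c j).2 v := by
  rw [yTuple_eq_smul hbc hn hj, map_smul, smul_eq_mul, pairForm_apply]
  rcases neg_one_pow_eq_or ℤ ((columnPair n b c j).1 + (columnPair n b c j).2 + 1) with h | h <;>
    rw [h]
  · left; ring
  · right; ring

theorem natAbs_spechtForm_diag (hn : 6 ≤ n) {i : ℕ} (hi : i ∈ Finset.Icc 1 (n * (n - 3) / 2)) :
    (spechtForm (shape n) n (xTuple n b c i) (yTuple n b c i)).natAbs =
      diagFactor n i * (2 * (n - 4).factorial) := by
  rw [← (isPivot_xTuple hbc hn hi).diag]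
  rcases spechtForm_yTuple hbc hn hi (xTuple n b c i) with h | h <;> rw [h]
  rw [Int.natAbs_neg]

omit hbc in
theorem diagFactor_pos (hn : 6 ≤ n) (i : ℕ) : 0 < diagFactor n i := by
  unfold diagFactor
  have : 0 < (n - 2) * (n - 1) := Nat.mul_pos (by omega) (by omega)
  split_ifs <;> omega

omit hbc in
-- Parity enters twice: 2 divides n-1 for odd n, and 2(n-1) divides (n-2)(n-1) for even n.
theorem diagFactor_dvd_succ (hn : 6 ≤ n) {i : ℕ} (hi : 1 ≤ i) :
    diagFactor n i ∣ diagFactor n (i + 1) := by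
  unfold diagFactor
  rw [if_neg (show ¬ i + 1 = 1 by omega)]
  by_cases h1 : i = 1
  · rw [if_pos h1, if_pos (show i + 1 ≤ n - 2 by omega)]
    split_ifs with h
    · obtain ⟨j, rfl⟩ := h
      exact ⟨j, by omega⟩
    · exact one_dvd _
  rw [if_neg h1]
  by_cases h2 : i ≤ n - 2
  · rw [if_pos h2]
    by_cases h3 : i + 1 ≤ n - 2
    · rw [if_pos h3]
    · rw [if_neg h3, if_pos (show i + 1 = n - 1 by omega)]
      exact dvd_mul_left _ _
  · rw [if_neg h2, if_neg (show ¬ i + 1 ≤ n - 2 by omega), if_neg (show ¬ i + 1 = n - 1 by omega)]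
    split_ifs with h3 h4
    · refine mul_dvd_mul_right ?_ _
      obtain ⟨j, rfl⟩ := h4
      exact ⟨j - 1, by omega⟩
    · rw [one_mul]
      exact dvd_mul_left _ _
    · exact dvd_rfl

theorem areTrigonalizingBases_tuples (hn : 6 ≤ n) :
    AreTrigonalizingBases (spechtForm (shape n) n)
      (fun i : Fin (n * (n - 3) / 2) => xTuple n b c (i + 1))
      (fun i : Fin (n * (n - 3) / 2) => yTuple n b c (i + 1)) := by
  have hmem : ∀ i : Fin (n * (n - 3) / 2), i.1 + 1 ∈ Finset.Icc 1 (n * (n - 3) / 2) :=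
    fun i => Finset.mem_Icc.2 (by omega)
  have hspan : ∀ (v : ℕ → Specht (shape n) n), ∀ i ∈ Finset.Icc 1 (n * (n - 3) / 2),
      v i ∈ Submodule.span ℤ (Set.range fun i : Fin (n * (n - 3) / 2) => v (i + 1)) := by
    intro v i hi
    rw [Finset.mem_Icc] at hi
    refine Submodule.subset_span ⟨⟨i - 1, by omega⟩, ?_⟩
    simp only
    congr 1
    omega
  refine areTrigonalizingBases_of_span
    (eq_top_of_xTuple_mem hbc hn _ (hspan (xTuple n b c)))
    (eq_top_of_yTuple_mem hbc hn _ (hspan (yTuple n b c))) (fun i => ?_) (fun i j hij => ?_)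
    (fun i j hij => ?_) (fun i j hij => ?_)
  · rw [← Int.natAbs_ne_zero, natAbs_spechtForm_diag hbc hn (hmem i)]
    have := diagFactor_pos hn (i.1 + 1)
    have := (n - 4).factorial_pos
    positivity
  · have := (isPivot_xTuple hbc hn (hmem i)).lower _ (hmem j) (by omega)
    rcases spechtForm_yTuple hbc hn (hmem j) (xTuple n b c (i.1 + 1)) with h | h <;>
      rw [h, this]
    rfl
  · obtain ⟨h1, h2, h3, h4⟩ := hbc.columnPair_mem hn (hmem j)
    have := (isPivot_xTuple hbc hn (hmem i)).dvd _ _ h1 h2 h3 h4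
    rw [← Int.natAbs_dvd, natAbs_spechtForm_diag hbc hn (hmem i)]
    push_cast
    rw [mul_comm]
    rcases spechtForm_yTuple hbc hn (hmem j) (xTuple n b c (i.1 + 1)) with h | h <;> rw [h]
    · exact this
    · exact (dvd_neg).2 this
  · rw [← Int.natAbs_dvd_natAbs, natAbs_spechtForm_diag hbc hn (hmem i),
      natAbs_spechtForm_diag hbc hn (hmem j), hij]
    exact mul_dvd_mul_right (diagFactor_dvd_succ hn (by omega)) _

theorem nonempty_formCokernel_equiv_prod (hn : 6 ≤ n) :
    Nonempty (FormCokernel (spechtForm (shape n) n) ≃+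
      ZMod ((if Odd n then 2 else 1) * (2 * Nat.factorial (n - 4))) ×
      (Fin (n - 3) → ZMod ((n - 1) * (2 * Nat.factorial (n - 4)))) ×
      ZMod ((if Even n then 2 else 1) * (n - 1) * (2 * Nat.factorial (n - 4))) ×
      (Fin ((n ^ 2 - 5 * n + 2) / 2) →
        ZMod ((n - 2) * (n - 1) * (2 * Nat.factorial (n - 4))))) := by
  obtain ⟨e⟩ := (areTrigonalizingBases_tuples hbc hn).elementary_divisors
  have hm : n * (n - 3) / 2 = 1 + (n - 3 + (1 + (n ^ 2 - 5 * n + 2) / 2)) := by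
    obtain ⟨k, rfl⟩ := Nat.exists_eq_add_of_le' hn
    have h1 : (k + 6) ^ 2 - 5 * (k + 6) + 2 = k ^ 2 + 7 * k + 8 := by
      have : (k + 6) ^ 2 = 5 * (k + 6) + (k ^ 2 + 7 * k + 6) := by ring
      omega
    have h2 : (k + 6) * (k + 6 - 3) = k ^ 2 + 7 * k + 8 + 2 * (k + 5) := by
      rw [show k + 6 - 3 = k + 3 by omega]; ring
    rw [h1, h2]
    omega
  have hD : ∀ i : Fin (n * (n - 3) / 2),
      (spechtForm (shape n) n (xTuple n b c (i.1 + 1)) (yTuple n b c (i.1 + 1))).natAbs =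
        diagFactor n (i.1 + 1) * (2 * (n - 4).factorial) := fun i =>
    natAbs_spechtForm_diag hbc hn (Finset.mem_Icc.2 (by omega))
  obtain ⟨e'⟩ := nonempty_pi_fin_succ_add_equiv hm
    (fun i => (spechtForm (shape n) n (xTuple n b c (i.1 + 1)) (yTuple n b c (i.1 + 1))).natAbs)
    ((if Odd n then 2 else 1) * (2 * Nat.factorial (n - 4)))
    ((n - 1) * (2 * Nat.factorial (n - 4)))
    ((if Even n then 2 else 1) * (n - 1) * (2 * Nat.factorial (n - 4)))
    ((n - 2) * (n - 1) * (2 * Nat.factorial (n - 4)))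
    (fun i hi => by rw [hD, diagFactor, if_pos (by omega)])
    (fun i hi hi' => by rw [hD, diagFactor, if_neg (by omega), if_pos (by omega)])
    (fun i hi => by
      rw [hD, diagFactor, if_neg (by omega), if_neg (by omega), if_pos (by omega)])
    (fun i hi => by
      rw [hD, diagFactor, if_neg (by omega), if_neg (by omega), if_neg (by omega)])
  exact ⟨e.trans e'⟩

end FormValues

end SpechtGram

end

theorem mainTheorem8 (n : ℕ) (hn : 6 ≤ n) :
    Nonempty (SpechtGram.FormCokernel (SpechtGram.spechtForm (SpechtGram.shape n) n) ≃+
      ZMod ((if Odd n then 2 else 1) * (2 * Nat.factorial (n - 4))) ×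
      (Fin (n - 3) → ZMod ((n - 1) * (2 * Nat.factorial (n - 4)))) ×
      ZMod ((if Even n then 2 else 1) * (n - 1) * (2 * Nat.factorial (n - 4))) ×
      (Fin ((n ^ 2 - 5 * n + 2) / 2) →
        ZMod ((n - 2) * (n - 1) * (2 * Nat.factorial (n - 4))))) ∧
    (∃ b c : ℕ → ℕ, SpechtGram.IsPairList n b c) ∧
    (∀ b c : ℕ → ℕ, SpechtGram.IsPairList n b c →
      SpechtGram.AreTrigonalizingBases (SpechtGram.spechtForm (SpechtGram.shape n) n)
        (fun i : Fin (n * (n - 3) / 2) => SpechtGram.xTuple n b c (i + 1))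
        (fun i : Fin (n * (n - 3) / 2) => SpechtGram.yTuple n b c (i + 1))) := by
  obtain ⟨b, c, hbc⟩ := SpechtGram.exists_isPairList (n := n) (by omega)
  exact ⟨SpechtGram.nonempty_formCokernel_equiv_prod hbc hn, ⟨b, c, hbc⟩,
    fun b c hbc => SpechtGram.areTrigonalizingBases_tuples hbc hn⟩
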